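/- All varieties are smooth, connected and projective over $\mathbb C$. Let $(X,\Delta)$ be an orbifold pair: $X$ is a variety and $\Delta=\sum_{i\in I}(1-\frac{b_i}{a_i})\Delta_i$ is a $\mathbb Q$-divisor whose support has simple normal crossings, with coefficients in $(0,1]$; here the $\Delta_i$ are distinct prime divisors, $0<b_i<a_i$ are coprime integers if the coefficient is $<1$, and $a_i=1$, $b_i=0$ if it is $1$. Let $\pi:Y\to X$ be a $\Delta$-adapted covering: a finite flat Galois covering with group $G$, with $Y$ a variety, which ramifies to the order exactly $a_i$ along every component of $\pi^{-1}(\Delta_i)$, and such that the support of $\pi^*\Delta+\operatorname{Ram}(\pi)$ and the branch locus of $\pi$ are divisors with simple normal crossings. Put $D^{(i)}=\frac1{a_i}\pi^*\Delta_i$. Let $\Omega^1(\pi,\Delta)$ be the kernel of the residue map $\pi^*\Omega^1_X(\log\lceil\Delta\rceil)\to\bigoplus_i\mathcal O_{b_iD^{(i)}}$ and let $T(\pi,\Delta)\subset\pi^*T_X$ be its dual. A subsheaf is understood to be coherent, and it is saturated if the quotient is torsion-free. Let $\mathcal F\subset T(\pi,\Delta)$ be a $\Delta$-foliation, that is, a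 $G$-stable subsheaf, saturated in $T(\pi,\Delta)$, such that the map $\bigwedge^2\mathcal F\to T(\pi,\Delta)/\mathcal F$ induced by the Lie bracket is zero. (This map is obtained as follows: the saturation $\mathcal F^s$ of $\mathcal F$ in $\pi^*T_X$ is $\pi^*\mathcal F_X$ for a unique saturated $\mathcal F_X\subset T_X$; the pullback by $\pi$ of the $\mathcal O_X$-linear map $\bigwedge^2\mathcal F_X\to T_X/\mathcal F_X$ given by the Lie bracket is a map $\bigwedge^2\mathcal F^s\to\pi^*T_X/\mathcal F^s$, and it sends $\bigwedge^2\mathcal F$ into the subsheaf $T(\pi,\Delta)/\mathcal F$.) Then there is a subsheaf $\mathcal F_X\subset T_X$ such that: 1. $\mathcal F^s=\pi^*\mathcal F_X$, and $\mathcal F_X$ is saturated in $T_X$; 2. $\mathcal F_X$ is closed under the Lie bracket, so that $\mathcal F_X$ is a foliation on $X$; 3. $K_{\mathcal F}=\pi^*(K_{\mathcal F_X}+\Delta^{hor})$ as divisor classes on $Y$ up to linear equivalence, that is, for every divisor $D$ in the class $K_{\mathcal F_X}$ the divisor $\pi^*(D+\Delta^{hor})$ is integral and lies in the class $K_{\mathcal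 F}$. Here $K_{\mathcal E}:=\det(\mathcal E^*)$, with $\det\mathcal E=(\bigwedge^{\operatorname{rk}\mathcal E}\mathcal E)^{**}$, and $\Delta^{hor}$ is the part of $\Delta$ (with the same coefficients) supported on the components $\Delta_i$ that are not invariant by $\mathcal F_X$; a prime divisor is invariant by $\mathcal F_X$ if all local vector fields in $\mathcal F_X$ preserve its ideal sheaf (equivalently, where $\mathcal F_X$ is regular, the divisor is a union of leaves). -/

import Mathlib

open AlgebraicGeometry CategoryTheory
open scoped TensorProduct

noncomputable section

namespace OrbifoldFoliation

/-! ## Smooth projective varieties over the complex numbers -/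

/-- `Spec ℂ`. -/
abbrev SpecC : Scheme.{0} := Spec (CommRingCat.of ℂ)

attribute [local instance] MvPolynomial.gradedAlgebra

/-- Projective `n`-space over `ℂ`, as `Proj ℂ[x₀, …, xₙ]`. -/
def complexProjectiveSpace (n : ℕ) : Scheme.{0} :=
  Proj (MvPolynomial.homogeneousSubmodule (Fin (n + 1)) ℂ)

/-- The structure morphism of projective space. -/
def complexProjectiveSpaceToSpec (n : ℕ) : complexProjectiveSpace n ⟶ SpecC :=
  Proj.toSpecZero (MvPolynomial.homogeneousSubmodule (Fin (n + 1)) ℂ) ≫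
    Spec.map (CommRingCat.ofHom
      (algebraMap ℂ (MvPolynomial.homogeneousSubmodule (Fin (n + 1)) ℂ 0)))

/-- The structure morphism `f : X ⟶ Spec ℂ` makes `X` smooth and projective. -/
structure IsSmoothProjective {X : Scheme.{0}} (f : X ⟶ SpecC) : Prop where
  smooth : Smooth f
  projective : ∃ (n : ℕ) (i : X ⟶ complexProjectiveSpace n),
    IsClosedImmersion i ∧ i ≫ complexProjectiveSpaceToSpec n = f

/-! ## Function fields, local rings, prime divisors -/

/-- The local ring `𝒪_{X,x}` of an integral scheme, inside the function field. -/
def localRing (X : Scheme.{0}) [IsIntegral X] (x : X) : Subring X.functionField :=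
  (algebraMap (X.presheaf.stalk x) X.functionField).range

/-- The function field of a complex variety is a `ℂ`-algebra through the structure morphism. -/
instance functionFieldComplexAlgebra (X : Scheme.{0}) [IsIntegral X] [X.Over SpecC] :
    Algebra ℂ X.functionField :=
  ((X.presheaf.germ ⊤ (genericPoint X) trivial).hom.comp
    (((X ↘ SpecC).appTop).hom.comp (Scheme.ΓSpecIso (CommRingCat.of ℂ)).inv.hom)).toAlgebra

/-- A prime divisor, given by its generic point: a point of codimension one. -/
structure PrimeDivisor (X : Scheme.{0}) where
  point : X
  codim_one : Order.coheight point = 1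

/-- The ideal in `𝒪_{X,x}` of a prime divisor `P` passing through `x`. -/
def PrimeDivisor.ideal {X : Scheme.{0}} (P : PrimeDivisor X) (x : X) (h : P.point ⤳ x) :
    Ideal (X.presheaf.stalk x) :=
  (IsLocalRing.maximalIdeal (X.presheaf.stalk P.point)).comap (X.presheaf.stalkSpecializes h).hom

/-- `z` is a local equation at `x` of the prime divisor `P` passing through `x`. -/
def PrimeDivisor.IsLocalEquation {X : Scheme.{0}} (P : PrimeDivisor X) (x : X)
    (z : X.presheaf.stalk x) : Prop :=
  ∃ h : P.point ⤳ x, Ideal.span {z} = P.ideal x h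

/-- A set of prime divisors of a regular scheme has simple normal crossings: at every point `x`,
local equations of the members through `x` form part of a regular system of parameters. -/
def IsSNC {X : Scheme.{0}} (S : Set (PrimeDivisor X)) : Prop :=
  ∀ x : X, ∃ z : {P : PrimeDivisor X // P ∈ S ∧ P.point ⤳ x} →
      IsLocalRing.maximalIdeal (X.presheaf.stalk x),
    (∀ P, PrimeDivisor.IsLocalEquation P.1 x (z P)) ∧
    LinearIndependent (IsLocalRing.ResidueField (X.presheaf.stalk x))
      (fun P => (IsLocalRing.maximalIdeal (X.presheaf.stalk x)).toCotangent (z P))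

/-- Coefficient functions of Weil `ℚ`-divisors. -/
abbrev QDivisor (X : Scheme.{0}) : Type := PrimeDivisor X → ℚ

/-- The stalk at `x` of the subsheaf `𝒪_X(D)` of the constant sheaf `ℂ(X)`:
the rational functions `g` with `div g + D ≥ 0` near `x`. -/
def divisorSheaf {X : Scheme.{0}} [IsIntegral X] [IsLocallyNoetherian X] (D : QDivisor X) (x : X) :
    Set X.functionField :=
  {g | g = 0 ∨ ∀ P : PrimeDivisor X, P.point ⤳ x → 0 ≤ (Scheme.ord g P.point : ℚ) + D P}

/-! ## The covering `π : Y ⟶ X` on function fields -/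

section Cover

variable {X Y : Scheme.{0}} [IsIntegral X] [IsIntegral Y]

lemma map_genericPoint_specializes (π : Y ⟶ X) [IsDominant π] :
    π (genericPoint Y) ⤳ genericPoint X := by
  have h1 : IsGenericPoint (π (genericPoint Y)) (closure (Set.range π)) := by
    have := (genericPoint_spec Y).image π.continuous
    rwa [Set.image_univ] at this
  rw [specializes_iff_mem_closure, h1.def, π.denseRange.closure_range]
  trivial

/-- The pullback of rational functions along a dominant morphism. -/
def pullbackFunctions (π : Y ⟶ X) [IsDominant π] : X.functionField →+* Y.functionField :=
  (π.stalkMap (genericPoint Y)).hom.comp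
    (X.presheaf.stalkSpecializes (map_genericPoint_specializes π)).hom

lemma genericPoint_mem_preimage (π : Y ⟶ X)
    [IsDominant π] (U : X.Opens) (hU : genericPoint X ∈ U) : genericPoint Y ∈ π ⁻¹ᵁ U :=
  (map_genericPoint_specializes π).mem_open U.isOpen hU

lemma pullbackFunctions_germ (π : Y ⟶ X)
    [IsDominant π] (U : X.Opens) (hU : genericPoint X ∈ U) (g : Γ(X, U)) :
    pullbackFunctions π (X.presheaf.germ U (genericPoint X) hU g) =
      Y.presheaf.germ (π ⁻¹ᵁ U) (genericPoint Y) (genericPoint_mem_preimage π U hU)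
        (π.app U g) := by
  have h1 : (X.presheaf.stalkSpecializes (map_genericPoint_specializes π)).hom
      (X.presheaf.germ U (genericPoint X) hU g) =
      X.presheaf.germ U (π (genericPoint Y)) (genericPoint_mem_preimage π U hU) g :=
    TopCat.Presheaf.germ_stalkSpecializes_apply _ _ _ _
  have h2 := Scheme.Hom.germ_stalkMap_apply π U (genericPoint Y)
    (genericPoint_mem_preimage π U hU) g
  unfold pullbackFunctions
  rw [RingHom.comp_apply, h1]
  exact h2

lemma pullbackFunctions_comp (π : Y ⟶ X) [IsDominant π] (σ : Y ≅ Y) (hσ : σ.hom ≫ π = π)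
    (c : X.functionField) :
    pullbackFunctions σ.hom (pullbackFunctions π c) = pullbackFunctions π c := by
  have key : ∀ (ρ : Y ⟶ X) [IsDominant ρ], ρ = π →
      pullbackFunctions ρ c = pullbackFunctions π c := by
    intro ρ _ h
    subst h
    rfl
  obtain ⟨U, hU, g, rfl⟩ := X.presheaf.exists_germ_eq c
  refine Eq.trans ?_ (key (σ.hom ≫ π) hσ)
  rw [pullbackFunctions_germ π, pullbackFunctions_germ σ.hom, pullbackFunctions_germ (σ.hom ≫ π)]
  rfl

/-- The function field of `Y`, seen as an extension of the function field of `X` through `π`. -/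
def FunctionFieldOver (_ : Y ⟶ X) : Type := Y.functionField

instance (π : Y ⟶ X) : Field (FunctionFieldOver π) := inferInstanceAs (Field Y.functionField)

instance (π : Y ⟶ X) : Algebra Y.functionField (FunctionFieldOver π) :=
  inferInstanceAs (Algebra Y.functionField Y.functionField)

instance (π : Y ⟶ X) [IsDominant π] : Algebra X.functionField (FunctionFieldOver π) :=
  RingHom.toAlgebra (S := FunctionFieldOver π) (pullbackFunctions π)

instance (π : Y ⟶ X) [IsDominant π] [X.Over SpecC] : Algebra ℂ (FunctionFieldOver π) :=
  ((algebraMap X.functionField (FunctionFieldOver π)).comp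
    (algebraMap ℂ X.functionField)).toAlgebra

instance (π : Y ⟶ X) [IsDominant π] [X.Over SpecC] :
    IsScalarTower ℂ X.functionField (FunctionFieldOver π) :=
  IsScalarTower.of_algebraMap_eq' rfl

instance (π : Y ⟶ X) [IsDominant π] :
    SMulCommClass Y.functionField X.functionField (FunctionFieldOver π) :=
  ⟨fun a b c => by simp only [Algebra.smul_def]; ring⟩

instance (π : Y ⟶ X) [IsDominant π] :
    SMulCommClass X.functionField Y.functionField (FunctionFieldOver π) :=
  SMulCommClass.symm _ _ _

instance (π : Y ⟶ X) [IsDominant π] [X.Over SpecC] :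
    SMulCommClass Y.functionField ℂ (FunctionFieldOver π) :=
  ⟨fun a b c => by simp only [Algebra.smul_def]; ring⟩

/-- The identity map from `FunctionFieldOver π` to the function field of `Y`. -/
def toFunctionField (π : Y ⟶ X) : FunctionFieldOver π ≃+* Y.functionField :=
  RingEquiv.refl Y.functionField

end Cover

/-! ## Subsheaves of constant sheaves

A torsion-free quasi-coherent sheaf on an integral scheme embeds into the constant sheaf attached
to its generic stalk, and a coherent subsheaf of a constant sheaf `V` is the same thing as the
family of its stalks, which are `𝒪_{X,x}`-submodules of `V`. All sheaves below are of this kind. -/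

section Sheaves

/-- A family of stalks `E_x ⊆ V` with `E_x` an `𝒪_{X,x}`-submodule of the `ℂ(X)`-vector
space `V`. -/
abbrev StalkFamily (X : Scheme.{0}) [IsIntegral X] (V : Type) [AddCommGroup V]
    [Module X.functionField V] : Type :=
  ∀ x : X, Submodule (localRing X x) V

variable {X : Scheme.{0}} [IsIntegral X] {V : Type} [AddCommGroup V] [Module X.functionField V]

/-- The family of stalks is that of a coherent subsheaf of the constant sheaf `V`: locally on `X`,
there are finitely many elements of `V` that generate all stalks. -/
def IsCoherent (E : StalkFamily X V) : Prop :=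
  ∀ x : X, ∃ U : X.Opens, x ∈ U ∧ ∃ s : Finset V,
    ∀ y ∈ U, E y = Submodule.span (localRing X y) (s : Set V)

/-- `F` is a subsheaf of `E` and the quotient `E/F` is torsion-free. -/
def IsSaturatedIn (F E : StalkFamily X V) : Prop :=
  ∀ x : X, F x ≤ E x ∧
    ∀ v ∈ E x, ∀ g : localRing X x, g ≠ 0 → g • v ∈ F x → v ∈ F x

/-- The saturation of `F` in `E`: the elements of `E` that are torsion modulo `F`. -/
def saturation (F E : StalkFamily X V) : StalkFamily X V := fun x =>
  { carrier := {v | v ∈ E x ∧ ∃ g : localRing X x, g ≠ 0 ∧ g • v ∈ F x}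
    zero_mem' := ⟨zero_mem _, 1, one_ne_zero, by simp⟩
    add_mem' := by
      rintro v w ⟨hv, g, hg, hgv⟩ ⟨hw, h, hh, hhw⟩
      refine ⟨add_mem hv hw, g * h, mul_ne_zero hg hh, ?_⟩
      rw [smul_add]
      refine add_mem ?_ ?_
      · rw [mul_comm, mul_smul]; exact (F x).smul_mem _ hgv
      · rw [mul_smul]; exact (F x).smul_mem _ hhw
    smul_mem' := by
      rintro c v ⟨hv, g, hg, hgv⟩
      refine ⟨(E x).smul_mem _ hv, g, hg, ?_⟩
      rw [smul_comm]; exact (F x).smul_mem _ hgv }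

/-- The generic stalk of `E`. -/
def genericStalk (E : StalkFamily X V) : Submodule X.functionField V :=
  Submodule.span X.functionField (⋃ x, (E x : Set V))

lemma mem_genericStalk (E : StalkFamily X V) {x : X} {v : V} (hv : v ∈ E x) :
    v ∈ genericStalk E :=
  Submodule.subset_span (Set.mem_iUnion.2 ⟨x, hv⟩)

/-- The dual sheaf `E^* = Hom(E, 𝒪_X)`, inside the dual of the generic stalk of `E`. -/
def dualSheaf (E : StalkFamily X V) :
    StalkFamily X (Module.Dual X.functionField (genericStalk E)) := fun x =>
  { carrier := {φ | ∀ (v : V) (hv : v ∈ E x), φ ⟨v, mem_genericStalk E hv⟩ ∈ localRing X x}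
    zero_mem' := fun v hv => by simp
    add_mem' := fun {φ ψ} hφ hψ v hv => by
      simpa using add_mem (hφ v hv) (hψ v hv)
    smul_mem' := fun c φ hφ v hv => by
      have := mul_mem c.2 (hφ v hv)
      simpa [Subring.smul_def] using this }

/-- The rank of `E`. -/
def sheafRank (E : StalkFamily X V) : ℕ := Module.finrank X.functionField (genericStalk E)

/-- The stalk at `x` of `⋀^r E` modulo torsion, with `r` the rank of `E`, inside `⋀^r V`. -/
def topExteriorPower (E : StalkFamily X V) :
    StalkFamily X (⋀[X.functionField]^(sheafRank E) V) := fun x =>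
  Submodule.span (localRing X x)
    {t | ∃ v : Fin (sheafRank E) → V, (∀ i, v i ∈ E x) ∧
      t = exteriorPower.ιMulti X.functionField (sheafRank E) v}

/-- `D` lies in the linear equivalence class `det E`, where `det E = (⋀^r E)^{**}`: it is the
divisor of a nonzero rational section `s` of `det E`. At the generic point of a prime divisor `P`
of a regular scheme, `⋀^r E` is already free of rank one modulo torsion, say with generator `t`,
and the order of `s = g • t` along `P` is that of `g`. -/
def IsDeterminantDivisor [IsLocallyNoetherian X] (E : StalkFamily X V)
    (D : PrimeDivisor X → ℤ) : Prop :=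
  ∃ s : ⋀[X.functionField]^(sheafRank E) V, s ≠ 0 ∧ ∀ P : PrimeDivisor X,
    ∃ (t : ⋀[X.functionField]^(sheafRank E) V) (g : X.functionField),
      topExteriorPower E P.point = Submodule.span (localRing X P.point) {t} ∧
      s = g • t ∧ D P = Scheme.ord g P.point

/-- `D` lies in the canonical class `K_E = det (E^*)`. -/
def IsCanonicalDivisor [IsLocallyNoetherian X] (E : StalkFamily X V)
    (D : PrimeDivisor X → ℤ) : Prop :=
  IsDeterminantDivisor (dualSheaf E) D

end Sheaves

/-! ## The tangent sheaf of `X` and foliations -/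

section Tangent

variable (X : Scheme.{0}) [IsIntegral X] [X.Over SpecC]

/-- The generic stalk of `T_X`: the `ℂ`-derivations of the function field. -/
abbrev RationalVectorField : Type := Derivation ℂ X.functionField X.functionField

/-- The tangent sheaf `T_X`: its stalk at `x` consists of the derivations of `𝒪_{X,x}`. -/
def tangentSheaf : StalkFamily X (RationalVectorField X) := fun x =>
  { carrier := {v | ∀ f ∈ localRing X x, v f ∈ localRing X x}
    zero_mem' := fun f _ => by simp
    add_mem' := fun {v w} hv hw f hf => by simpa using add_mem (hv f hf) (hw f hf)
    smul_mem' := fun c v hv f hf => by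
      have := mul_mem c.2 (hv f hf)
      simpa [Subring.smul_def] using this }

variable {X}

/-- A foliation: a coherent subsheaf of `T_X`, saturated in `T_X`, closed under the Lie
bracket. -/
structure IsFoliation (F : StalkFamily X (RationalVectorField X)) : Prop where
  coherent : IsCoherent F
  saturated : IsSaturatedIn F (tangentSheaf X)
  bracket : ∀ x : X, ∀ u ∈ F x, ∀ v ∈ F x, ⁅u, v⁆ ∈ F x

/-- The prime divisor `P` is invariant by `F`: the vector fields in `F` preserve the ideal sheaf
of `P`, that is, they are tangent to `P`. -/
def IsInvariant (F : StalkFamily X (RationalVectorField X)) (P : PrimeDivisor X) : Prop :=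
  ∀ (x : X) (h : P.point ⤳ x), ∀ v ∈ F x, ∀ f ∈ P.ideal x h, ∃ g ∈ P.ideal x h,
    v (algebraMap (X.presheaf.stalk x) X.functionField f) =
      algebraMap (X.presheaf.stalk x) X.functionField g

open scoped Classical in
/-- The part of `D` that is horizontal with respect to `F`: the components that are not invariant,
with the same coefficients. -/
def horizontalPart (F : StalkFamily X (RationalVectorField X)) (D : QDivisor X) : QDivisor X :=
  fun P => if IsInvariant F P then 0 else D P

end Tangent

/-! ## Orbifold pairs and adapted coverings -/

section Orbifold

variable {X Y : Scheme.{0}} [IsIntegral X] [IsIntegral Y]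

/-- `(X, Δ)` is an orbifold pair: the coefficients of `Δ` are rational numbers between `0` and `1`
and the support of `Δ` has simple normal crossings. -/
structure IsOrbifold (Δ : PrimeDivisor X →₀ ℚ) : Prop where
  coeff_nonneg : ∀ P, 0 ≤ Δ P
  coeff_le_one : ∀ P, Δ P ≤ 1
  snc : IsSNC {P | P ∈ Δ.support}

/-- The integer `a` in `Δ P = 1 - b/a` in lowest terms (`a = 1`, `b = 0` if `Δ P = 1`). -/
def orbA (Δ : PrimeDivisor X →₀ ℚ) (P : PrimeDivisor X) : ℕ := (1 - Δ P).den

/-- The integer `b` in `Δ P = 1 - b/a` in lowest terms (`a = 1`, `b = 0` if `Δ P = 1`). -/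
def orbB (Δ : PrimeDivisor X →₀ ℚ) (P : PrimeDivisor X) : ℤ := (1 - Δ P).num

/-- The ramification index of `π` along `Q`: the multiplicity of `Q` in `π^* P`, where `P` is the
image of `Q`, that is, the length of `𝒪_{Y,Q} / 𝔪_P 𝒪_{Y,Q}`. -/
def ramificationIndex (π : Y ⟶ X) (Q : PrimeDivisor Y) : ℕ :=
  (Module.length (Y.presheaf.stalk Q.point) (Y.presheaf.stalk Q.point ⧸
    (IsLocalRing.maximalIdeal (X.presheaf.stalk (π Q.point))).map
      (π.stalkMap Q.point).hom)).toNat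

open scoped Classical in
/-- The pullback of a divisor by a finite flat morphism (which maps points of codimension one to
points of codimension one). -/
def pullbackDivisor (π : Y ⟶ X) (D : QDivisor X) : QDivisor Y := fun Q =>
  if h : Order.coheight (π Q.point) = 1 then (ramificationIndex π Q : ℚ) * D ⟨π Q.point, h⟩ else 0

/-- The ramification divisor `∑ (e_Q - 1) Q` of a finite flat morphism. -/
def ramificationDivisor (π : Y ⟶ X) : QDivisor Y := fun Q => (ramificationIndex π Q : ℚ) - 1

/-- The prime divisors of `X` contained in the branch locus of `π`. -/
def branchLocus (π : Y ⟶ X) : Set (PrimeDivisor X) :=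
  {P | ∃ Q : PrimeDivisor Y, π Q.point = P.point ∧ ramificationDivisor π Q ≠ 0}

/-- `π : Y ⟶ X` is a `Δ`-adapted covering. -/
structure IsAdaptedCover [X.Over SpecC] (π : Y ⟶ X) [IsDominant π] (Δ : PrimeDivisor X →₀ ℚ) :
    Prop where
  smoothProjective : IsSmoothProjective (π ≫ (X ↘ SpecC))
  finite : IsFinite π
  flat : Flat π
  galois : IsGalois X.functionField (FunctionFieldOver π)
  ramification : ∀ P ∈ Δ.support, ∀ Q : PrimeDivisor Y, π Q.point = P.point →
    ramificationIndex π Q = orbA Δ P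
  snc : IsSNC {Q | pullbackDivisor π Δ Q + ramificationDivisor π Q ≠ 0}
  snc_branch : IsSNC (branchLocus π)

/-! ## Pulled back sheaves and the orbifold tangent sheaf -/

variable [X.Over SpecC]

/-- The generic stalk of `π^* T_X`: the `ℂ`-derivations `ℂ(X) → ℂ(Y)`. -/
abbrev PullbackVectorField (π : Y ⟶ X) [IsDominant π] : Type :=
  Derivation ℂ X.functionField (FunctionFieldOver π)

/-- The pullback `π^* v` of a rational vector field `v`. -/
def pullbackVectorField (π : Y ⟶ X) [IsDominant π] (v : RationalVectorField X) :
    PullbackVectorField π :=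
  (Algebra.linearMap X.functionField (FunctionFieldOver π)).compDer v

/-- The pullback `π^* E` of a subsheaf `E` of `T_X` by the flat morphism `π`. -/
def pullbackSheaf (π : Y ⟶ X) [IsDominant π] (E : StalkFamily X (RationalVectorField X)) :
    StalkFamily Y (PullbackVectorField π) := fun y =>
  Submodule.span (localRing Y y) (pullbackVectorField π '' (E (π y) : Set (RationalVectorField X)))

/-- The generic stalk of `π^* Ω^1_X`. -/
abbrev PullbackForm (π : Y ⟶ X) [IsDominant π] : Type :=
  FunctionFieldOver π ⊗[X.functionField] Ω[X.functionField⁄ℂ]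

/-- The logarithmic differential `dz/z`. -/
def dlog (z : X.functionField) : Ω[X.functionField⁄ℂ] :=
  z⁻¹ • KaehlerDifferential.D ℂ X.functionField z

/-- The orbifold cotangent sheaf `Ω^1(π, Δ)`, that is, the kernel of the residue map
`π^* Ω^1_X(log ⌈Δ⌉) → ⨁_i 𝒪_{b_i D_i}` with `D_i = (1/a_i) π^* Δ_i`. The source is generated by
the forms `π^* df` and `π^* (dz/z)`, with `z` a local equation of one of the `Δ_i`, and the residue
of `η + ∑ g_i π^* (dz_i/z_i)`, with `η` in `π^* Ω^1_X`, is the class of `(g_i)`; so the kernel is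
generated by the `π^* df` and the `g π^* (dz/z)` with `g` in the ideal of `b_i D_i`. -/
def orbifoldCotangent [IsLocallyNoetherian Y] (π : Y ⟶ X) [IsDominant π]
    (Δ : PrimeDivisor X →₀ ℚ) : StalkFamily Y (PullbackForm π) := fun y =>
  Submodule.span (localRing Y y)
    ({ω | ∃ f ∈ localRing X (π y), ω = 1 ⊗ₜ KaehlerDifferential.D ℂ X.functionField f} ∪
     {ω | ∃ P ∈ Δ.support, ∃ z : X.presheaf.stalk (π y), P.IsLocalEquation (π y) z ∧
        ∃ g : FunctionFieldOver π,
          toFunctionField π g ∈ divisorSheaf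
            (-((orbB Δ P : ℚ) • (1 / (orbA Δ P : ℚ)) • pullbackDivisor π (Finsupp.single P 1))) y ∧
          ω = g ⊗ₜ dlog (algebraMap (X.presheaf.stalk (π y)) X.functionField z)})

/-- The pairing between (rational sections of) `π^* T_X` and `π^* Ω^1_X`. -/
def pairing (π : Y ⟶ X) [IsDominant π] (v : PullbackVectorField π) (ω : PullbackForm π) :
    Y.functionField :=
  toFunctionField π (LinearMap.liftBaseChange (FunctionFieldOver π) v.liftKaehlerDifferential ω)

lemma liftKaehler_add (π : Y ⟶ X) [IsDominant π] (v w : PullbackVectorField π) :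
    (v + w).liftKaehlerDifferential = v.liftKaehlerDifferential + w.liftKaehlerDifferential := by
  apply Derivation.liftKaehlerDifferential_unique
  ext f
  simp

lemma liftKaehler_smul (π : Y ⟶ X) [IsDominant π] (c : Y.functionField)
    (v : PullbackVectorField π) :
    (c • v).liftKaehlerDifferential = c • v.liftKaehlerDifferential := by
  apply Derivation.liftKaehlerDifferential_unique
  ext f
  simp

lemma pairing_zero (π : Y ⟶ X) [IsDominant π] (ω : PullbackForm π) :
    pairing π 0 ω = 0 := by
  have h0 : (0 : PullbackVectorField π).liftKaehlerDifferential = 0 := by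
    apply Derivation.liftKaehlerDifferential_unique
    ext f
    simp
  unfold pairing
  induction ω using TensorProduct.induction_on with
  | zero => simp
  | tmul g η => simp [h0]
  | add a b ha hb => simp only [map_add, ha, hb, add_zero]

lemma pairing_add (π : Y ⟶ X) [IsDominant π] (v w : PullbackVectorField π)
    (ω : PullbackForm π) : pairing π (v + w) ω = pairing π v ω + pairing π w ω := by
  unfold pairing
  induction ω using TensorProduct.induction_on with
  | zero => simp
  | tmul g η => simp [liftKaehler_add]
  | add a b ha hb => simp only [map_add, ha, hb]; abel

lemma pairing_smul (π : Y ⟶ X) [IsDominant π] (c : Y.functionField) (v : PullbackVectorField π)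
    (ω : PullbackForm π) : pairing π (c • v) ω = c * pairing π v ω := by
  unfold pairing
  induction ω using TensorProduct.induction_on with
  | zero => simp
  | tmul g η =>
    simp only [liftKaehler_smul, LinearMap.liftBaseChange_tmul, LinearMap.smul_apply, smul_eq_mul,
      map_mul]
    exact mul_left_comm _ _ _
  | add a b ha hb => simp only [map_add, ha, hb, mul_add]

/-- The orbifold tangent sheaf `T(π, Δ)`: the dual of `Ω^1(π, Δ)`, inside the generic stalk of
`π^* T_X`. -/
def orbifoldTangent [IsLocallyNoetherian Y] (π : Y ⟶ X) [IsDominant π]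
    (Δ : PrimeDivisor X →₀ ℚ) : StalkFamily Y (PullbackVectorField π) := fun y =>
  { carrier := {v | ∀ ω ∈ orbifoldCotangent π Δ y, pairing π v ω ∈ localRing Y y}
    zero_mem' := fun ω _ => by rw [pairing_zero]; exact zero_mem _
    add_mem' := fun {v w} hv hw ω hω => by
      rw [pairing_add]; exact add_mem (hv ω hω) (hw ω hω)
    smul_mem' := fun c v hv ω hω => by
      rw [Subring.smul_def, pairing_smul]; exact mul_mem c.2 (hv ω hω) }

/-! ## Foliations on the covering -/

/-- The pullback of rational functions on `Y` by an automorphism of `Y` over `X`, as a linear map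
over the function field of `X`. -/
def galoisAction (π : Y ⟶ X) [IsDominant π] (σ : Y ≅ Y) (hσ : σ.hom ≫ π = π) :
    FunctionFieldOver π →ₗ[X.functionField] FunctionFieldOver π :=
  { toFun := fun g => (toFunctionField π).symm (pullbackFunctions σ.hom (toFunctionField π g))
    map_add' := fun a b => by simp
    map_smul' := fun c a => by
      have h : ∀ b : X.functionField, algebraMap X.functionField (FunctionFieldOver π) b =
        (toFunctionField π).symm (pullbackFunctions π b) := fun _ => rfl
      simp only [Algebra.smul_def, h, map_mul, RingEquiv.apply_symm_apply, RingHom.id_apply,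
        pullbackFunctions_comp π σ hσ] }

/-- `F` is stable under the Galois group `Aut (Y/X)`, acting on `π^* T_X`. -/
def IsGaloisStable (π : Y ⟶ X) [IsDominant π] (F : StalkFamily Y (PullbackVectorField π)) : Prop :=
  ∀ (σ : Y ≅ Y) (hσ : σ.hom ≫ π = π) (y : Y),
    ∀ v ∈ F (σ.hom y), (galoisAction π σ hσ).compDer v ∈ F y

/-- The restriction to `F` of the pullback by `π` of the `𝒪_X`-bilinear map
`F_X × F_X → T_X / F_X` induced by the Lie bracket vanishes. This pullback is the `𝒪_Y`-bilinear
map sending `(∑ g_i π^* u_i, ∑ h_j π^* v_j)`, with `u_i` and `v_j` in `F_X`, to the class of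
`∑ g_i h_j π^* [u_i, v_j]` modulo `π^* F_X`. -/
def PullbackBracketVanishes (π : Y ⟶ X) [IsDominant π]
    (FX : StalkFamily X (RationalVectorField X)) (F : StalkFamily Y (PullbackVectorField π)) :
    Prop :=
  ∀ (y : Y) (m n : ℕ) (g : Fin m → localRing Y y) (u : Fin m → RationalVectorField X)
    (h : Fin n → localRing Y y) (v : Fin n → RationalVectorField X),
    (∀ i, u i ∈ FX (π y)) → (∀ j, v j ∈ FX (π y)) →
    ∑ i, g i • pullbackVectorField π (u i) ∈ F y →
    ∑ j, h j • pullbackVectorField π (v j) ∈ F y →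
    ∑ i, ∑ j, (g i * h j) • pullbackVectorField π ⁅u i, v j⁆ ∈ pullbackSheaf π FX y

/-- A `Δ`-foliation: a coherent subsheaf `F` of `T(π, Δ)`, saturated in `T(π, Δ)` and stable under
the Galois group, such that the map `⋀² F → T(π, Δ) / F` induced by the Lie bracket is zero.

That map is defined as follows. Let `F^s` be the saturation of `F` in `π^* T_X` and write
`F^s = π^* F_X` with `F_X` saturated in `T_X` (such an `F_X` is unique). The bracket on `X` gives
`⋀² F_X → T_X / F_X`, whose pullback `⋀² F^s → π^* T_X / F^s` maps `⋀² F` to the subsheaf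
`T(π, Δ) / F` of `π^* T_X / F^s`. -/
structure IsDeltaFoliation [IsLocallyNoetherian Y] (π : Y ⟶ X) [IsDominant π]
    (Δ : PrimeDivisor X →₀ ℚ) (F : StalkFamily Y (PullbackVectorField π)) : Prop where
  coherent : IsCoherent F
  saturated : IsSaturatedIn F (orbifoldTangent π Δ)
  galoisStable : IsGaloisStable π F
  bracket : ∀ FX : StalkFamily X (RationalVectorField X),
    IsCoherent FX → IsSaturatedIn FX (tangentSheaf X) →
    saturation F (pullbackSheaf π (tangentSheaf X)) = pullbackSheaf π FX →
    PullbackBracketVanishes π FX F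

end Orbifold

end OrbifoldFoliation

end

open OrbifoldFoliation

/-!
Write `K = ℂ(X)` and `L = ℂ(Y)`. A coherent sheaf of vector fields that is saturated in a given
sheaf is determined by its generic stalk, so the argument takes place in the `L`-space of
derivations `K → L`, together with local computations at points of codimension one.

Since `Y` is smooth, it is normal, hence it is the normalization of `X` in `L`, and every element
of `Gal(L/K)` is induced by an automorphism of `Y` over `X` (`exists_automorphism`). The generic
stalk `W` of `F` is therefore stable under `Gal(L/K)`. Taking traces, `W` is generated over `L` by
the `K`-space `W_K` of rational vector fields on `X` whose pullback lies in `W`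
(`span_descendedFields`), and `FX` is the sheaf of vector fields on `X` that lie in `W_K`. It is
coherent because its sections over an affine chart form a submodule of a finite free module
(`vectorFieldsIn_coherent`). The equational criterion of flatness gives `π^* T_X ∩ W = π^* FX`
(`mem_pullbackSheaf_vectorFieldsIn`), which is the first assertion; as `F` and `π^* FX` agree
generically, the bracket condition on `F` descends to `FX` (`vectorFieldsIn_bracket`).

For the canonical classes, let `Q` be a prime divisor of `Y`, `P` its image in `X`, `z` a local
equation of `P` and `a`, `b` the integers attached to `P`. A canonical divisor of a sheaf is
computed at a prime divisor by the determinant of a local basis with respect to a fixed basis of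
the generic stalk (`IsCanonicalDivisor.exists_ord_eq`, `isCanonicalDivisor_of_ord_eq`). Along `Q`
the elements of `F` are the regular elements `v` of `W` for which `v z` has order at least `a - b`
when `P` is a component of `Δ` (`mem_orbifoldTangent_iff`). For an invariant component, `v z` is
divisible by `z`, which has order `a` along `Q`, so the second condition is empty; hence
`F = π^* FX` along `Q` unless `P` is a component of `Δ` that is not invariant. In that case
`v ↦ v z` is a coordinate in a suitable local basis of `FX`, and a basis of `F` is obtained from it
by multiplying one basis vector by the `(a - b)`-th power of a uniformizer
(`exists_adapted_stalkBasis`). As `a - b` is `a` times the coefficient of `P` in `Δ`, this is the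
contribution of `π^* Δ^hor`.
-/

noncomputable section

namespace OrbifoldFoliation

/-! ### Smooth algebras over a field are normal -/

/-- A domain that is étale over a normal domain `R` is normal: integral closures commute with
smooth base change, and `B ⊗ Frac R` is the fraction field of `B`. -/
lemma isIntegrallyClosed_of_etale (R B : Type*) [CommRing R] [IsDomain R] [IsIntegrallyClosed R]
    [CommRing B] [IsDomain B] [Algebra R B] [Algebra.Etale R B] : IsIntegrallyClosed B := by
  let Q := FractionRing R
  let C := B ⊗[R] Q
  have hloc : IsLocalization (Algebra.algebraMapSubmonoid B (nonZeroDivisors R)) C := inferInstance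
  have hM : Algebra.algebraMapSubmonoid B (nonZeroDivisors R) ≤ nonZeroDivisors B := by
    rintro _ ⟨r, hr, rfl⟩
    exact map_mem_nonZeroDivisors _ (FaithfulSMul.algebraMap_injective R B) hr
  have hC : IsDomain C := IsLocalization.isDomain_of_le_nonZeroDivisors C hM
  let e : Q ⊗[R] B ≃ₐ[R] C := Algebra.TensorProduct.comm R Q B
  have : IsDomain (Q ⊗[R] B) := e.toMulEquiv.isDomain C
  have : Module.Finite Q (Q ⊗[R] B) := Algebra.FormallyUnramified.finite_of_free Q _
  have hF : IsField C := e.symm.toMulEquiv.isField (IsField.of_isDomain_of_finite Q (Q ⊗[R] B))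
  let : Field C := hF.toField
  have hfrac : IsFractionRing B C := by
    refine IsFractionRing.of_field B C fun z => ?_
    obtain ⟨⟨x, y⟩, hxy⟩ := IsLocalization.surj
      (Algebra.algebraMapSubmonoid B (nonZeroDivisors R)) z
    refine ⟨x, y, ?_⟩
    have hy : algebraMap B C y ≠ 0 := (IsLocalization.map_units C y).ne_zero
    rw [eq_div_iff hy]
    exact hxy
  refine (isIntegrallyClosed_iff C).2 fun {x} hx => ?_
  obtain ⟨t, ht⟩ := (TensorProduct.toIntegralClosure_bijective_of_smooth
    (R := R) (S := B) (B := Q)).2 ⟨x, hx⟩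
  have key : ∀ t : B ⊗[R] integralClosure R Q, ∃ y : B,
      (TensorProduct.toIntegralClosure R B Q t : C) = algebraMap B C y := by
    intro t
    induction t using TensorProduct.induction_on with
    | zero => exact ⟨0, by simp⟩
    | tmul b q =>
      obtain ⟨r, hr⟩ := IsIntegrallyClosed.isIntegral_iff.1 q.2
      refine ⟨r • b, ?_⟩
      have : (TensorProduct.toIntegralClosure R B Q (b ⊗ₜ q) : C) = b ⊗ₜ (q : Q) := by
        simp [TensorProduct.toIntegralClosure]
      rw [this, ← hr, Algebra.TensorProduct.algebraMap_apply, Algebra.algebraMap_self,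
        RingHom.id_apply, TensorProduct.smul_tmul, Algebra.algebraMap_eq_smul_one]
    | add a b ha hb =>
      obtain ⟨y, hy⟩ := ha
      obtain ⟨z, hz⟩ := hb
      exact ⟨y + z, by simp [hy, hz]⟩
  obtain ⟨y, hy⟩ := key t
  exact ⟨y, by rw [← hy, ht]⟩

/-- A smooth domain over a field is normal, being locally étale over a polynomial ring. -/
lemma isIntegrallyClosed_of_smooth (k B : Type*) [Field k] [CommRing B] [IsDomain B]
    [Algebra k B] [Algebra.Smooth k B] : IsIntegrallyClosed B := by
  refine IsIntegrallyClosed.of_localization_maximal fun p _ _ => ?_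
  obtain ⟨f, hf, n, _, _, _⟩ := Algebra.IsSmoothAt.exists_isStandardEtale_mvPolynomial
    (R := k) (S := B) (p := p)
  have hf0 : f ≠ 0 := fun h => hf (h ▸ p.zero_mem)
  have hle : Submonoid.powers f ≤ nonZeroDivisors B :=
    powers_le_nonZeroDivisors_of_noZeroDivisors hf0
  have : IsDomain (Localization.Away f) := IsLocalization.isDomain_localization hle
  have hcl : IsIntegrallyClosed (Localization.Away f) :=
    isIntegrallyClosed_of_etale (MvPolynomial (Fin n) k) _
  have hle' : Submonoid.powers f ≤ p.primeCompl := by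
    rintro _ ⟨m, rfl⟩
    exact fun h => hf (Ideal.IsPrime.mem_of_pow_mem inferInstance m h)
  let : Algebra (Localization.Away f) (Localization.AtPrime p) :=
    IsLocalization.localizationAlgebraOfSubmonoidLe _ _ (Submonoid.powers f) p.primeCompl hle'
  have : IsScalarTower B (Localization.Away f) (Localization.AtPrime p) :=
    IsLocalization.localization_isScalarTower_of_submonoid_le _ _ _ _ hle'
  have hl := IsLocalization.isLocalization_of_submonoid_le (Localization.Away f)
    (Localization.AtPrime p) (Submonoid.powers f) p.primeCompl hle'
  refine isIntegrallyClosed_of_isLocalization (R := Localization.Away f)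
    (S := Localization.AtPrime p) (Submonoid.map (algebraMap B (Localization.Away f))
      p.primeCompl) ?_
  rintro _ ⟨x, hx, rfl⟩
  exact map_mem_nonZeroDivisors _ (IsLocalization.injective _ hle)
    (p.primeCompl_le_nonZeroDivisors hx)

/-! ### Lattices cut out by linear functionals -/

section Lattice

variable {K W : Type*} [Field K] [AddCommGroup W] [Module K W]

/-- Every basis of the dual of a finite-dimensional space is the coordinate system of a basis. -/
lemma exists_basis_coord_eq [Module.Finite K W] {ι : Type*} [Finite ι] [DecidableEq ι]
    (φ : Module.Basis ι K (Module.Dual K W)) :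
    ∃ b : Module.Basis ι K W, ∀ i, b.coord i = φ i := by
  refine ⟨φ.dualBasis.map (Module.evalEquiv K W).symm, fun i => ?_⟩
  refine Module.Basis.ext (φ.dualBasis.map (Module.evalEquiv K W).symm) fun j => ?_
  have h : φ i ((Module.evalEquiv K W).symm (φ.dualBasis j)) = φ.dualBasis j (φ i) :=
    Module.apply_evalEquiv_symm_apply ..
  rw [Module.Basis.coord_apply, Module.Basis.repr_self, Module.Basis.map_apply, h,
    Module.Basis.dualBasis_apply, Module.Basis.repr_self, Finsupp.single_apply,
    Finsupp.single_apply]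
  simp only [eq_comm]

/-- A separating set `N` of functionals on a finite-dimensional `K`-space, with bounded
denominators at every vector, spans a lattice in the dual space, because `R` is a principal ideal
domain. The dual basis of a basis of that lattice is a basis of the lattice of vectors at which the
functionals in `N` take values in `R`, and its coordinates are combinations of members of `N`. -/
lemma exists_basis_of_functionals [Module.Finite K W] (R : Subring K) [IsPrincipalIdealRing R]
    [IsFractionRing R K] (N : Set (Module.Dual K W))
    (hsep : ∀ w, (∀ φ ∈ N, φ w = 0) → w = 0)
    (hbd : ∀ w, ∃ r ∈ R, r ≠ 0 ∧ ∀ φ ∈ N, r * φ w ∈ R) :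
    ∃ b : Module.Basis (Fin (Module.finrank K W)) K W,
      (∀ i, b.coord i ∈ Submodule.span R N) ∧
      ∀ w, (∀ φ ∈ N, φ w ∈ R) ↔ ∀ i, b.coord i w ∈ R := by
  classical
  set N' : Submodule R (Module.Dual K W) := Submodule.span R N with hN'
  have hfg : N'.FG := by
    let e := Module.finBasis K W
    choose r hrR hr0 hr using hbd
    refine Submodule.FG.of_le (T := Submodule.span R (Set.range fun j =>
      (r (e j))⁻¹ • e.coord j)) (Submodule.fg_span (Set.finite_range _)) ?_
    refine Submodule.span_le.2 fun φ hφ => ?_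
    have : φ = ∑ j, (⟨r (e j) * φ (e j), hr _ φ hφ⟩ : R) • (r (e j))⁻¹ • e.coord j := by
      refine e.ext fun i => ?_
      rw [LinearMap.sum_apply, Finset.sum_eq_single i]
      · simp [Subring.smul_def]
        field_simp [hr0 (e i)]
      · intro j _ hj
        simp [Subring.smul_def, hj.symm]
      · simp
    rw [this]
    exact Submodule.sum_mem _ fun j _ => Submodule.smul_mem _ _
      (Submodule.subset_span ⟨j, rfl⟩)
  have hspan : Submodule.span K (N' : Set (Module.Dual K W)) = ⊤ := by
    have h1 : (Submodule.span K (N' : Set (Module.Dual K W))).dualCoannihilator = ⊥ := by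
      rw [eq_bot_iff]
      intro w hw
      rw [Submodule.mem_dualCoannihilator] at hw
      exact hsep w fun φ hφ => hw φ (Submodule.subset_span (Submodule.subset_span hφ))
    rw [← Subspace.dualCoannihilator_dualAnnihilator_eq
      (W := Submodule.span K (N' : Set (Module.Dual K W))), h1, Submodule.dualAnnihilator_bot]
  have hl : Submodule.IsLattice K N' := ⟨hfg, hspan⟩
  have hfree : Module.Free R N' := Submodule.IsLattice.free K N'
  have hfin : Module.Finite R N' := Module.Finite.iff_fg.2 hfg
  have hrk : Module.finrank R N' = Module.finrank K W := by
    rw [← Subspace.dual_finrank_eq (K := K) (V := W), Module.finrank, Module.finrank,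
      Submodule.IsLattice.rank' K N']
  let bN := Module.finBasisOfFinrankEq R N' hrk
  obtain ⟨b, hb⟩ := exists_basis_coord_eq (bN.extendOfIsLattice K)
  have hb' : ∀ i, b.coord i = (bN i : Module.Dual K W) := fun i => by
    rw [hb, Module.Basis.extendOfIsLattice_apply]
  refine ⟨b, fun i => hb' i ▸ (bN i).2, fun w => ⟨fun h i => ?_, fun h φ hφ => ?_⟩⟩
  · rw [hb']
    refine Submodule.span_induction (p := fun φ _ => φ w ∈ R) h ?_ ?_ ?_ (bN i).2
    · simp
    · intro x y _ _ hx hy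
      exact add_mem hx hy
    · intro a x _ hx
      exact mul_mem a.2 hx
  · have h1 := bN.sum_repr ⟨φ, Submodule.subset_span hφ⟩
    have h2 : φ = ∑ i, bN.repr ⟨φ, Submodule.subset_span hφ⟩ i • (bN i : Module.Dual K W) := by
      have h3 := congrArg N'.subtype h1
      rw [map_sum] at h3
      exact h3.symm
    rw [h2, LinearMap.sum_apply]
    refine sum_mem fun i _ => ?_
    rw [← hb']
    exact mul_mem (SetLike.coe_mem _) (h i)

/-- If the functional `ℓ` takes a unit value at a member of the lattice basis `b`, then `ℓ` can
replace the corresponding coordinate. -/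
lemma exists_basis_replace_coord (R : Subring K) {ι : Type*} [Fintype ι] [DecidableEq ι]
    (b : Module.Basis ι K W) (ℓ : Module.Dual K W) (hℓ : ∀ i, ℓ (b i) ∈ R) (i₀ : ι)
    (h0 : ℓ (b i₀) ≠ 0) (hinv : (ℓ (b i₀))⁻¹ ∈ R) :
    ∃ b' : Module.Basis ι K W, (∀ i ≠ i₀, b'.coord i = b.coord i) ∧ b'.coord i₀ = ℓ ∧
      ∀ w, (∀ i, b'.coord i w ∈ R) ↔ ∀ i, b.coord i w ∈ R := by
  have hexp : ∀ w, ℓ w = ∑ i, b.coord i w * ℓ (b i) := fun w => by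
    conv_lhs => rw [← b.sum_repr w, map_sum]
    exact Finset.sum_congr rfl fun i _ => by rw [map_smul, smul_eq_mul, Module.Basis.coord_apply]
  let T : W →ₗ[K] (ι → K) := LinearMap.pi fun i => if i = i₀ then ℓ else b.coord i
  have hT : ∀ w i, T w i = if i = i₀ then ℓ w else b.coord i w := fun w i => by
    simp only [T, LinearMap.pi_apply]
    split_ifs <;> rfl
  have hTinj : Function.Injective T := by
    rw [injective_iff_map_eq_zero]
    intro w hw
    have h1 : ∀ i ≠ i₀, b.coord i w = 0 := fun i hi => by
      simpa [hT, hi] using congrFun hw i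
    have h2 : ℓ w = 0 := by simpa [hT] using congrFun hw i₀
    rw [hexp, Finset.sum_eq_single i₀ (fun i _ hi => by simp [h1 i hi]) (by simp)] at h2
    refine b.ext_elem fun i => ?_
    by_cases hi : i = i₀
    · subst hi
      simpa using (mul_eq_zero.1 h2).resolve_right h0
    · simpa using h1 i hi
  let e : W ≃ₗ[K] (ι → K) := LinearEquiv.ofInjectiveOfFinrankEq T hTinj (by
    rw [Module.finrank_eq_card_basis b, Module.finrank_fintype_fun_eq_card])
  have he : ∀ w i, (Module.Basis.ofEquivFun e).coord i w =
      if i = i₀ then ℓ w else b.coord i w := fun w i => by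
    rw [← hT]
    rfl
  refine ⟨Module.Basis.ofEquivFun e, fun i hi => LinearMap.ext fun w => ?_,
    LinearMap.ext fun w => ?_, fun w => ⟨fun h i => ?_, fun h i => ?_⟩⟩
  · rw [he, if_neg hi]
  · rw [he, if_pos rfl]
  · have h1 : ∀ j ≠ i₀, b.coord j w ∈ R := fun j hj => by
      have := h j
      rwa [he, if_neg hj] at this
    by_cases hi : i = i₀
    · subst hi
      have h2 : ℓ w ∈ R := by
        have := h i
        rwa [he, if_pos rfl] at this
      have h3 := hexp w
      rw [← Finset.add_sum_erase _ _ (Finset.mem_univ i)] at h3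
      have h4 : b.coord i w =
          (ℓ w - ∑ j ∈ Finset.univ.erase i, b.coord j w * ℓ (b j)) * (ℓ (b i))⁻¹ := by
        rw [h3]
        field_simp
        ring
      rw [h4]
      exact mul_mem (sub_mem h2 (sum_mem fun j hj =>
        mul_mem (h1 j (Finset.ne_of_mem_erase hj)) (hℓ j))) hinv
    · exact h1 i hi
  · rw [he]
    split_ifs
    · rw [hexp]
      exact sum_mem fun j _ => mul_mem (h j) (hℓ j)
    · exact h i

end Lattice

/-! ### Top exterior powers -/

section Exterior

variable {K V : Type*} [Field K] [AddCommGroup V] [Module K V] {n : ℕ}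

lemma ιMulti_eq_det_smul (β : Module.Basis (Fin n) K V) (v : Fin n → V) :
    exteriorPower.ιMulti K n v = β.det v • exteriorPower.ιMulti K n β := by
  have : exteriorPower.ιMulti K n =
      β.det.smulRight (exteriorPower.ιMulti K n β) := by
    refine Module.Basis.ext_alternating β fun s hs => ?_
    let σ : Equiv.Perm (Fin n) := Equiv.ofBijective s (Finite.injective_iff_bijective.1 hs)
    have h1 : (fun i => β (s i)) = β ∘ σ := rfl
    rw [h1, AlternatingMap.map_perm, AlternatingMap.map_perm, β.det.smulRight_apply,
      Module.Basis.det_self, one_smul]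
  conv_lhs => rw [this]
  rfl

lemma ιMulti_basis_ne_zero (β : Module.Basis (Fin n) K V) :
    exteriorPower.ιMulti K n β ≠ 0 := by
  intro h
  have := congrArg (exteriorPower.alternatingMapLinearEquiv β.det) h
  rw [exteriorPower.alternatingMapLinearEquiv_apply_ιMulti, map_zero, Module.Basis.det_self] at this
  exact one_ne_zero this

lemma exists_eq_smul_ιMulti (β : Module.Basis (Fin n) K V) (s : ⋀[K]^n V) :
    ∃ c : K, s = c • exteriorPower.ιMulti K n β := by
  have hs : s ∈ Submodule.span K (Set.range (exteriorPower.ιMulti K n (M := V))) := by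
    rw [exteriorPower.ιMulti_span]; trivial
  induction hs using Submodule.span_induction with
  | mem x hx =>
    obtain ⟨v, rfl⟩ := hx
    exact ⟨_, ιMulti_eq_det_smul β v⟩
  | zero => exact ⟨0, (zero_smul _ _).symm⟩
  | add x y _ _ hx hy =>
    obtain ⟨c, rfl⟩ := hx
    obtain ⟨d, rfl⟩ := hy
    exact ⟨c + d, (add_smul _ _ _).symm⟩
  | smul a x _ hx =>
    obtain ⟨c, rfl⟩ := hx
    exact ⟨a * c, (mul_smul _ _ _).symm⟩

lemma dualBasis_det_dualBasis (b b₀ : Module.Basis (Fin n) K V) :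
    b.dualBasis.det b₀.dualBasis = b₀.det b := by
  rw [Module.Basis.det_apply, Module.Basis.det_apply, ← Matrix.det_transpose]
  congr 1
  ext i j
  simp [Module.Basis.toMatrix_apply]

end Exterior

/-! ### Local rings inside the function field -/

section LocalRings

variable {X : Scheme.{0}} [IsIntegral X]

lemma genericPoint_mem_of_mem {U : X.Opens} {x : X} (hx : x ∈ U) : genericPoint X ∈ U :=
  ((genericPoint_spec X).specializes trivial).mem_open U.isOpen hx

lemma algebraMap_stalk_germ {U : X.Opens} {x : X} (hx : x ∈ U) (g : Γ(X, U)) :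
    algebraMap (X.presheaf.stalk x) X.functionField (X.presheaf.germ U x hx g) =
      X.presheaf.germ U (genericPoint X) (genericPoint_mem_of_mem hx) g := by
  have : (X.presheaf.stalkSpecializes ((genericPoint_spec X).specializes trivial)).hom
      (X.presheaf.germ U x hx g) =
      X.presheaf.germ U (genericPoint X) (genericPoint_mem_of_mem hx) g :=
    TopCat.Presheaf.germ_stalkSpecializes_apply _ _ _ _
  exact this

lemma germ_mem_localRing {U : X.Opens} {x : X} (hx : x ∈ U) (h : genericPoint X ∈ U)
    (g : Γ(X, U)) : X.presheaf.germ U (genericPoint X) h g ∈ localRing X x :=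
  ⟨X.presheaf.germ U x hx g, algebraMap_stalk_germ hx g⟩

lemma algebraMap_stalk_injective (x : X) :
    Function.Injective (algebraMap (X.presheaf.stalk x) X.functionField) :=
  IsFractionRing.injective _ _

/-- The stalk at `x` is isomorphic to its image in the function field. -/
def stalkEquiv (x : X) : X.presheaf.stalk x ≃+* localRing X x :=
  RingEquiv.ofBijective (algebraMap (X.presheaf.stalk x) X.functionField).rangeRestrict
    ⟨fun _ _ h => algebraMap_stalk_injective x (congrArg Subtype.val h),
      RingHom.rangeRestrict_surjective _⟩

instance (x : X) : IsFractionRing (localRing X x) X.functionField := by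
  refine IsFractionRing.of_field _ _ fun z => ?_
  obtain ⟨a, b, -, h⟩ := IsFractionRing.div_surjective (A := X.presheaf.stalk x) z
  exact ⟨stalkEquiv x a, stalkEquiv x b, h.symm⟩

lemma localRing_mono {x y : X} (h : x ⤳ y) : localRing X y ≤ localRing X x := by
  rintro _ ⟨f, rfl⟩
  obtain ⟨U, hU, g, rfl⟩ := X.presheaf.exists_germ_eq f
  rw [algebraMap_stalk_germ]
  exact germ_mem_localRing (h.mem_open U.isOpen hU) _ _

lemma localRing_genericPoint : localRing X (genericPoint X) = ⊤ := by
  refine eq_top_iff.2 fun f _ => ?_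
  obtain ⟨U, hU, g, rfl⟩ := X.presheaf.exists_germ_eq f
  exact germ_mem_localRing hU _ _

lemma algebraMap_stalkSpecializes {x y : X} (h : x ⤳ y) (f : X.presheaf.stalk y) :
    algebraMap (X.presheaf.stalk x) X.functionField ((X.presheaf.stalkSpecializes h).hom f) =
      algebraMap (X.presheaf.stalk y) X.functionField f := by
  obtain ⟨U, hU, g, rfl⟩ := X.presheaf.exists_germ_eq f
  have h1 : (X.presheaf.stalkSpecializes h).hom (X.presheaf.germ U y hU g) =
      X.presheaf.germ U x (h.mem_open U.isOpen hU) g :=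
    TopCat.Presheaf.germ_stalkSpecializes_apply _ _ _ _
  rw [h1, algebraMap_stalk_germ, algebraMap_stalk_germ]

/-- A unit of the local ring, in terms of inverses in the function field. -/
lemma isUnit_stalk_iff {x : X} {f : X.presheaf.stalk x} (hf : f ≠ 0) :
    IsUnit f ↔ (algebraMap (X.presheaf.stalk x) X.functionField f)⁻¹ ∈ localRing X x := by
  have hf' : algebraMap (X.presheaf.stalk x) X.functionField f ≠ 0 := by
    rwa [Ne, map_eq_zero_iff _ (algebraMap_stalk_injective x)]
  constructor
  · rintro ⟨u, rfl⟩
    refine ⟨(↑u⁻¹ : X.presheaf.stalk x), eq_inv_of_mul_eq_one_left ?_⟩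
    rw [← map_mul, Units.inv_mul, map_one]
  · rintro ⟨g, hg⟩
    refine IsUnit.of_mul_eq_one g (algebraMap_stalk_injective x ?_)
    rw [map_mul, map_one, hg, mul_inv_cancel₀ hf']

/-- On an affine open set, germs are fractions of sections. -/
lemma exists_germ_mul_eq {X : Scheme.{0}} {U : X.Opens} (hU : IsAffineOpen U) {y : X} (hy : y ∈ U)
    (f : X.presheaf.stalk y) : ∃ g s : Γ(X, U), IsUnit (X.presheaf.germ U y hy s) ∧
      f * X.presheaf.germ U y hy s = X.presheaf.germ U y hy g := by
  let := X.presheaf.algebra_section_stalk ⟨y, hy⟩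
  have := hU.isLocalization_stalk ⟨y, hy⟩
  obtain ⟨⟨g, s⟩, h⟩ := IsLocalization.surj
    (hU.primeIdealOf ⟨y, hy⟩).asIdeal.primeCompl f
  exact ⟨g, s, IsLocalization.map_units (X.presheaf.stalk y) s, h⟩

section Over

variable [X.Over SpecC]

/-- An affine chart around a point `x` of a scheme locally of finite type over `ℂ`: a finitely
generated subalgebra `A` of the function field whose localizations are the local rings at the
points of an open neighbourhood of `x`. -/
lemma exists_chart [LocallyOfFiniteType (X ↘ SpecC)] (x : X) :
    ∃ (U : X.Opens) (A : Subalgebra ℂ X.functionField), x ∈ U ∧ A.FG ∧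
      ∀ y ∈ U, (∀ a ∈ A, a ∈ localRing X y) ∧
        ∀ f ∈ localRing X y, ∃ a ∈ A, ∃ s ∈ A, s ≠ 0 ∧ s⁻¹ ∈ localRing X y ∧ f = a * s⁻¹ := by
  obtain ⟨_, ⟨U, hU, rfl⟩, hxU, -⟩ :=
    X.isBasis_affineOpens.exists_subset_of_mem_open (Set.mem_univ x) isOpen_univ
  have hgen : genericPoint X ∈ U := genericPoint_mem_of_mem hxU
  let φ : ℂ →+* Γ(X, U) := ((X ↘ SpecC).appLE ⊤ U le_top).hom.comp
    (Scheme.ΓSpecIso (CommRingCat.of ℂ)).inv.hom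
  let ψ : Γ(X, U) →+* X.functionField := (X.presheaf.germ U (genericPoint X) hgen).hom
  have hφ : φ.FiniteType := by
    refine RingHom.FiniteType.comp ((X ↘ SpecC).finiteType_appLE (isAffineOpen_top _) hU le_top)
      (RingHom.FiniteType.of_surjective _ ?_)
    exact (Scheme.ΓSpecIso (CommRingCat.of ℂ)).symm.commRingCatIsoToRingEquiv.surjective
  have hcomp : ∀ c, ψ (φ c) = algebraMap ℂ X.functionField c := by
    intro c
    change X.presheaf.germ U _ hgen (((X ↘ SpecC).appLE ⊤ U le_top).hom _) =
      X.presheaf.germ ⊤ _ trivial (((X ↘ SpecC).appTop).hom _)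
    exact TopCat.Presheaf.germ_res_apply X.presheaf (homOfLE le_top) _ hgen _
  algebraize [φ]
  let Ψ : Γ(X, U) →ₐ[ℂ] X.functionField := { ψ with commutes' := hcomp }
  refine ⟨U, Ψ.range, hxU, ?_, fun y hy => ⟨?_, ?_⟩⟩
  · rw [← Algebra.map_top]
    exact Subalgebra.FG.map _ (Algebra.FiniteType.out)
  · rintro _ ⟨g, rfl⟩
    exact germ_mem_localRing hy _ _
  · rintro _ ⟨f, rfl⟩
    obtain ⟨g, s, hs, h⟩ := exists_germ_mul_eq hU hy f
    have hs0 : X.presheaf.germ U y hy s ≠ 0 := hs.ne_zero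
    have h1 : ∀ t, Ψ t = algebraMap (X.presheaf.stalk y) X.functionField
        (X.presheaf.germ U y hy t) := fun t => (algebraMap_stalk_germ hy t).symm
    have hs1 : Ψ s ≠ 0 := by
      rwa [h1, Ne, map_eq_zero_iff _ (algebraMap_stalk_injective y)]
    refine ⟨Ψ g, ⟨g, rfl⟩, Ψ s, ⟨s, rfl⟩, hs1, ?_, ?_⟩
    · rw [h1]
      exact (isUnit_stalk_iff hs0).1 hs
    · rw [eq_mul_inv_iff_mul_eq₀ hs1, h1, h1, ← map_mul, h]

end Over

end LocalRings

/-! ### Smooth varieties are normal; orders of vanishing -/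

section Normal

variable {X : Scheme.{0}} [IsIntegral X]

/-- The coordinate rings of the affine open subsets of a smooth variety are normal. -/
lemma isIntegrallyClosed_section (f : X ⟶ SpecC) [Smooth f] {U : X.Opens} (hU : IsAffineOpen U)
    [Nonempty U] : IsIntegrallyClosed Γ(X, U) := by
  let φ : ℂ →+* Γ(X, U) := (f.appLE ⊤ U le_top).hom.comp
    (Scheme.ΓSpecIso (CommRingCat.of ℂ)).inv.hom
  have hφ : φ.Smooth := RingHom.Smooth.comp (RingHom.Smooth.of_bijective
    (Scheme.ΓSpecIso (CommRingCat.of ℂ)).symm.commRingCatIsoToRingEquiv.bijective)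
    (f.smooth_appLE (isAffineOpen_top _) hU le_top)
  algebraize [φ]
  exact isIntegrallyClosed_of_smooth ℂ _

lemma isIntegrallyClosed_stalk (f : X ⟶ SpecC) [Smooth f] (x : X) :
    IsIntegrallyClosed (X.presheaf.stalk x) := by
  obtain ⟨_, ⟨U, hU, rfl⟩, hxU, -⟩ :=
    X.isBasis_affineOpens.exists_subset_of_mem_open (Set.mem_univ x) isOpen_univ
  have : Nonempty U := ⟨⟨x, hxU⟩⟩
  have : IsIntegrallyClosed Γ(X, U) := isIntegrallyClosed_section f hU
  let := X.presheaf.algebra_section_stalk ⟨x, hxU⟩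
  have := hU.isLocalization_stalk ⟨x, hxU⟩
  exact isIntegrallyClosed_of_isLocalization (X.presheaf.stalk x)
    (hU.primeIdealOf ⟨x, hxU⟩).asIdeal.primeCompl (Ideal.primeCompl_le_nonZeroDivisors _)

variable [IsLocallyNoetherian X]

/-- The local rings of a smooth variety at points of codimension one are discrete valuation
rings. -/
lemma isDiscreteValuationRing_stalk (f : X ⟶ SpecC) [Smooth f] {x : X}
    (hx : Order.coheight x = 1) : IsDiscreteValuationRing (X.presheaf.stalk x) := by
  have hcl := isIntegrallyClosed_stalk f x
  have hdim : ringKrullDim (X.presheaf.stalk x) = 1 := by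
    rw [ringKrullDim_stalk_eq_coheight, hx]
    rfl
  have hnf : ¬ IsField (X.presheaf.stalk x) := fun h => by
    have := ringKrullDim_eq_zero_of_isField h
    rw [hdim] at this
    exact one_ne_zero this
  have : Ring.KrullDimLE 1 (X.presheaf.stalk x) := krullDimLE_of_coheight_le hx.le
  have : Ring.DimensionLEOne (X.presheaf.stalk x) :=
    ⟨fun {p} hp hprime => Ring.krullDimLE_one_iff_of_noZeroDivisors.1 this p hp hprime⟩
  have : IsDedekindDomain (X.presheaf.stalk x) :=
    { (inferInstance : IsDomain (X.presheaf.stalk x)) with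
      toIsDedekindRing := { toIsIntegralClosure := by infer_instance } }
  exact ((IsDiscreteValuationRing.TFAE _ hnf).out 0 2).2 this

lemma ord_one_eq {x : X} (hx : Order.coheight x = 1) :
    Scheme.ord (1 : X.functionField) x = 0 := by
  rw [Scheme.ord_eq_iff hx one_ne_zero]
  simp

lemma ord_inv_eq {x : X} (hx : Order.coheight x = 1)
    {f : X.functionField} (hf : f ≠ 0) : Scheme.ord f⁻¹ x = - Scheme.ord f x := by
  have := Scheme.ord_mul (x := x) hf (inv_ne_zero hf)
  rw [mul_inv_cancel₀ hf, ord_one_eq hx] at this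
  linarith

lemma ord_algebraMap_eq_length {x : X} (hx : Order.coheight x = 1)
    {f : X.presheaf.stalk x} (hf : f ≠ 0) :
    Scheme.ord (algebraMap (X.presheaf.stalk x) X.functionField f) x =
      (Module.length (X.presheaf.stalk x) (X.presheaf.stalk x ⧸ Ideal.span {f})).toNat := by
  have hd : Ring.KrullDimLE 1 (X.presheaf.stalk x) := krullDimLE_of_coheight_le hx.le
  have hf' : algebraMap (X.presheaf.stalk x) X.functionField f ≠ 0 := by
    rwa [Ne, map_eq_zero_iff _ (algebraMap_stalk_injective x)]
  rw [Scheme.ord_eq_iff hx hf', Scheme.ordHom, Ring.ordFrac_eq_ord _ hf]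
  refine Ring.ordMonoidWithZeroHom_eq_coe _ (mem_nonZeroDivisors_of_ne_zero hf) ?_
  exact (ENat.natCast_toNat (Ring.ord_ne_top (mem_nonZeroDivisors_of_ne_zero hf))).symm

lemma ord_algebraMap_nonneg {x : X} (hx : Order.coheight x = 1)
    (f : X.presheaf.stalk x) :
    0 ≤ Scheme.ord (algebraMap (X.presheaf.stalk x) X.functionField f) x := by
  by_cases hf : f = 0
  · simp [hf]
  · rw [ord_algebraMap_eq_length hx hf]
    exact Int.natCast_nonneg _

lemma ord_algebraMap_eq_zero_iff {x : X} [IsDiscreteValuationRing (X.presheaf.stalk x)]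
    (hx : Order.coheight x = 1)
    {f : X.presheaf.stalk x} (hf : f ≠ 0) :
    Scheme.ord (algebraMap (X.presheaf.stalk x) X.functionField f) x = 0 ↔ IsUnit f := by
  have hd : Ring.KrullDimLE 1 (X.presheaf.stalk x) := krullDimLE_of_coheight_le hx.le
  have hf' : algebraMap (X.presheaf.stalk x) X.functionField f ≠ 0 := by
    rwa [Ne, map_eq_zero_iff _ (algebraMap_stalk_injective x)]
  rw [Scheme.ord_eq_iff hx hf',
    Ring.isUnit_iff_ordFrac_one_of_isDiscreteValuationRing (K := X.functionField)]
  rfl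

lemma mem_localRing_iff_ord {x : X} [IsDiscreteValuationRing (X.presheaf.stalk x)]
    (hx : Order.coheight x = 1)
    {f : X.functionField} (hf : f ≠ 0) :
    f ∈ localRing X x ↔ 0 ≤ Scheme.ord f x := by
  constructor
  · rintro ⟨g, rfl⟩
    exact ord_algebraMap_nonneg hx g
  · intro h
    by_contra hn
    obtain ⟨g, hg⟩ := (ValuationRing.isInteger_or_isInteger (X.presheaf.stalk x) f).resolve_left hn
    have hg0 : g ≠ 0 := by
      rintro rfl
      rw [map_zero] at hg
      exact inv_ne_zero hf hg.symm
    have h1 := ord_inv_eq hx hf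
    rw [← hg] at h1
    have h2 := ord_algebraMap_nonneg hx g
    have h3 : IsUnit g := (ord_algebraMap_eq_zero_iff hx hg0).1 (by omega)
    rw [isUnit_stalk_iff hg0, hg, inv_inv] at h3
    exact hn h3

lemma ord_irreducible {x : X} [IsDiscreteValuationRing (X.presheaf.stalk x)]
    (hx : Order.coheight x = 1)
    {f : X.presheaf.stalk x} (hf : Irreducible f) :
    Scheme.ord (algebraMap (X.presheaf.stalk x) X.functionField f) x = 1 := by
  have h : Module.length (X.presheaf.stalk x) (X.presheaf.stalk x ⧸ Ideal.span {f}) = 1 :=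
    Ring.ord_of_irreducible hf
  rw [ord_algebraMap_eq_length hx hf.ne_zero, h]
  rfl

lemma ord_zpow_eq {x : X} (hx : Order.coheight x = 1)
    {f : X.functionField} (hf : f ≠ 0) (n : ℤ) :
    Scheme.ord (f ^ n) x = n * Scheme.ord f x := by
  have hd : Ring.KrullDimLE 1 (X.presheaf.stalk x) := krullDimLE_of_coheight_le hx.le
  rw [Scheme.ord_eq_iff hx (zpow_ne_zero n hf), map_zpow₀,
    (Scheme.ord_eq_iff hx hf (n := Scheme.ord f x)).1 rfl, ← WithZero.coe_zpow, ← ofAdd_zsmul,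
    smul_eq_mul]

end Normal

/-! ### Extending Galois automorphisms to the covering -/

section Automorphisms

/-- A normal integral scheme `Y`, integral over `X`, is the normalization of `X` in the function
field of `Y`. -/
lemma isIso_normalizationDesc {X Y : Scheme.{0}} [IsIntegral Y] (π : Y ⟶ X) [IsIntegralHom π]
    [QuasiCompact (Y.fromSpecStalk (genericPoint Y) ≫ π)]
    (hY : ∀ U : Y.Opens, IsAffineOpen U → Nonempty U → IsIntegrallyClosed Γ(Y, U)) :
    IsIso ((Y.fromSpecStalk (genericPoint Y) ≫ π).normalizationDesc
      (Y.fromSpecStalk (genericPoint Y)) π rfl) := by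
  set ι := Y.fromSpecStalk (genericPoint Y) with hι
  set t := (ι ≫ π).toNormalization with ht
  set j := (ι ≫ π).normalizationDesc ι π rfl with hj
  have htj : t ≫ j = ι := Scheme.Hom.toNormalization_normalizationDesc ..
  refine IsZariskiLocalAtTarget.of_forall_exists_morphismRestrict
    (P := MorphismProperty.isomorphisms Scheme) (f := j) fun y => ?_
  obtain ⟨_, ⟨V : Y.Opens, hV, rfl⟩, hyV, -⟩ :=
    Y.isBasis_affineOpens.exists_subset_of_mem_open (Set.mem_univ y) isOpen_univ
  refine ⟨V, hyV, (isIso_morphismRestrict_iff_isIso_app j hV).2 ?_⟩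
  rw [ConcreteCategory.isIso_iff_bijective]
  have hVne : Nonempty V := ⟨⟨y, hyV⟩⟩
  have hgen : genericPoint Y ∈ V := genericPoint_mem_of_mem hyV
  have hcl := hY V hV hVne
  have htop : (⊤ : (Spec Y.functionField).Opens) ≤ t ⁻¹ᵁ j ⁻¹ᵁ V := by
    rintro p -
    change j (t p) ∈ V
    rw [← Scheme.Hom.comp_apply, htj]
    have h1 : ι p ∈ Set.range ι := ⟨p, rfl⟩
    rw [hι, Scheme.range_fromSpecStalk] at h1
    exact Specializes.mem_open h1 V.isOpen hgen
  -- sections over `j ⁻¹ᵁ V` are rational functions, integral over the normal ring `Γ(Y, V)`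
  let θ : Γ((ι ≫ π).normalization, j ⁻¹ᵁ V) →+* Y.functionField :=
    (Scheme.ΓSpecIso _).hom.hom.comp (t.appLE (j ⁻¹ᵁ V) ⊤ htop).hom
  have hθ : Function.Injective θ := by
    refine (Scheme.ΓSpecIso _).commRingCatIsoToRingEquiv.injective.comp ?_
    have : IsSchemeTheoreticallyDominant t := .of_isDominant t
    have h1 := t.app_injective (j ⁻¹ᵁ V)
    have h2 : (⊤ : (Spec Y.functionField).Opens) = t ⁻¹ᵁ j ⁻¹ᵁ V := le_antisymm htop le_top
    have : IsIso ((Spec Y.functionField).presheaf.map (homOfLE htop).op) := by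
      have : IsIso (homOfLE htop) := ⟨homOfLE le_top, rfl, rfl⟩
      infer_instance
    rw [Scheme.Hom.appLE]
    exact ((ConcreteCategory.isIso_iff_bijective
      ((Spec Y.functionField).presheaf.map (homOfLE htop).op)).1 this).1.comp h1
  have hθj : ∀ b, θ (j.app V b) = Y.presheaf.germ V (genericPoint Y) hgen b := by
    intro b
    have h1 : j.app V ≫ t.appLE (j ⁻¹ᵁ V) ⊤ htop ≫ (Scheme.ΓSpecIso _).hom =
        Y.presheaf.germ V (genericPoint Y) hgen := by
      have h3 : ∀ (f : Spec Y.functionField ⟶ Y) (hf : f = Y.fromSpecStalk (genericPoint Y))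
          (e : ⊤ ≤ f ⁻¹ᵁ V),
          f.appLE V ⊤ e ≫ (Scheme.ΓSpecIso _).hom = Y.presheaf.germ V (genericPoint Y) hgen := by
        rintro f rfl e
        rw [Scheme.Hom.appLE, Scheme.fromSpecStalk_app hgen]
        have : (Spec Y.functionField).presheaf.map (homOfLE (le_top : _ ≤ ⊤)).op ≫
            (Spec Y.functionField).presheaf.map (homOfLE e).op = 𝟙 _ := by
          rw [← Functor.map_comp]
          exact (Spec Y.functionField).presheaf.map_id _
        simp only [Category.assoc, reassoc_of% this, Iso.inv_hom_id, Category.comp_id]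
      rw [Scheme.Hom.app_eq_appLE, Scheme.Hom.appLE_comp_appLE_assoc]
      exact h3 _ (htj.trans hι) _
    exact congrArg (fun φ => φ.hom b) h1
  constructor
  · intro a b hab
    have := congrArg θ hab
    rw [hθj, hθj] at this
    exact germ_injective_of_isIntegral Y (genericPoint Y) hgen this
  · intro x
    have hx : (j.app V).hom.IsIntegralElem x := j.isIntegral_app V hV x
    have : IsFractionRing Γ(Y, V) Y.functionField :=
      functionField_isFractionRing_of_isAffineOpen Y V hV
    have hx' : IsIntegral Γ(Y, V) (θ x) := by
      obtain ⟨p, hp, h0⟩ := hx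
      refine ⟨p, hp, ?_⟩
      have := congrArg θ h0
      rw [map_zero, Polynomial.hom_eval₂] at this
      rw [← this]
      congr 1
      ext b
      exact (hθj b).symm
    obtain ⟨b, hb⟩ := IsIntegrallyClosed.isIntegral_iff.1 hx'
    refine ⟨b, hθ ?_⟩
    rw [← hb]
    exact hθj b

variable {X Y : Scheme.{0}} [IsIntegral X] [IsIntegral Y]

lemma fromSpecStalk_genericPoint_comp (π : Y ⟶ X) [IsDominant π] :
    Y.fromSpecStalk (genericPoint Y) ≫ π =
      Spec.map (CommRingCat.ofHom (pullbackFunctions π)) ≫ X.fromSpecStalk (genericPoint X) := by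
  have : CommRingCat.ofHom (pullbackFunctions π) =
      X.presheaf.stalkSpecializes (map_genericPoint_specializes π) ≫
        π.stalkMap (genericPoint Y) := rfl
  rw [this, Spec.map_comp, Category.assoc, Scheme.SpecMap_stalkSpecializes_fromSpecStalk,
    Scheme.SpecMap_stalkMap_fromSpecStalk]

instance : IsDominant (Y.fromSpecStalk (genericPoint Y)) := by
  refine ⟨?_⟩
  have h := Scheme.range_fromSpecStalk (X := Y) (x := genericPoint Y)
  refine Dense.mono (s₁ := {genericPoint Y}) ?_ ?_
  · rw [h, Set.singleton_subset_iff]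
    exact specializes_rfl (x := genericPoint Y)
  · rw [dense_iff_closure_eq]
    exact (genericPoint_spec Y).def

/-- An automorphism of the function field of `Y` over that of `X` comes from an automorphism of `Y`
over `X`, because `Y` is the normalization of `X` in its function field. -/
lemma exists_automorphism [IsLocallyNoetherian X] (π : Y ⟶ X) [IsDominant π] [IsIntegralHom π]
    (hY : ∀ U : Y.Opens, IsAffineOpen U → Nonempty U → IsIntegrallyClosed Γ(Y, U))
    (σ : FunctionFieldOver π ≃ₐ[X.functionField] FunctionFieldOver π) :
    ∃ (s : Y ≅ Y) (hs : s.hom ≫ π = π), ∀ g, galoisAction π s hs g = σ g := by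
  let ι := Y.fromSpecStalk (genericPoint Y)
  have hι : ι = Y.fromSpecStalk (genericPoint Y) := rfl
  have hqc : QuasiCompact (ι ≫ π) := inferInstance
  have hiso : IsIso ((ι ≫ π).normalizationDesc ι π rfl) := isIso_normalizationDesc π hY
  let S (τ : FunctionFieldOver π ≃ₐ[X.functionField] FunctionFieldOver π) :
      Spec Y.functionField ⟶ Spec Y.functionField :=
    Spec.map (CommRingCat.ofHom (R := Y.functionField) (S := Y.functionField)
      (τ : FunctionFieldOver π →+* FunctionFieldOver π))
  have hS : ∀ τ, S τ ≫ ι ≫ π = ι ≫ π := by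
    intro τ
    rw [hι, fromSpecStalk_genericPoint_comp, ← Category.assoc, ← Spec.map_comp]
    congr 2
    ext c
    exact τ.commutes c
  have hSmul : ∀ τ τ', S (τ * τ') = S τ ≫ S τ' := by
    intro τ τ'
    rw [← Spec.map_comp]
    rfl
  have hSone : S 1 = 𝟙 _ := Spec.map_id _
  -- the universal property of the normalization extends `S τ` to `Y`
  have key : ∀ τ, ∃ s : Y ⟶ Y, s ≫ π = π ∧ ι ≫ s = S τ ≫ ι := by
    intro τ
    have h1 : ι ≫ π = (S τ ≫ ι) ≫ π := by rw [Category.assoc, hS]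
    refine ⟨inv ((ι ≫ π).normalizationDesc ι π rfl) ≫
      (ι ≫ π).normalizationDesc (S τ ≫ ι) π h1, ?_, ?_⟩
    · rw [Category.assoc, Scheme.Hom.normalizationDesc_comp, IsIso.inv_comp_eq,
        Scheme.Hom.normalizationDesc_comp]
    · have h2 : ι ≫ inv ((ι ≫ π).normalizationDesc ι π rfl) = (ι ≫ π).toNormalization := by
        rw [IsIso.comp_inv_eq, Scheme.Hom.toNormalization_normalizationDesc]
      rw [reassoc_of% h2, Scheme.Hom.toNormalization_normalizationDesc]
  choose s hsπ hsι using key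
  have hinv : ∀ τ τ', τ * τ' = 1 → s τ' ≫ s τ = 𝟙 Y := by
    intro τ τ' h
    refine ext_of_isDominant_of_isSeparated π ?_ ι ?_
    · rw [Category.assoc, hsπ, hsπ, Category.id_comp]
    · have : τ' * τ = 1 := mul_eq_one_comm.1 h
      rw [reassoc_of% hsι τ', hsι, ← Category.assoc, ← hSmul, this, hSone, Category.id_comp,
        Category.comp_id]
  refine ⟨⟨s σ, s σ⁻¹, hinv _ _ (inv_mul_cancel σ), hinv _ _ (mul_inv_cancel σ)⟩, hsπ σ, ?_⟩
  intro g
  have hdom : IsDominant (s σ) := by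
    have : IsIso (s σ) := ⟨s σ⁻¹, hinv _ _ (inv_mul_cancel σ), hinv _ _ (mul_inv_cancel σ)⟩
    infer_instance
  have h1 := fromSpecStalk_genericPoint_comp (s σ)
  rw [← hι, hsι σ, cancel_mono] at h1
  have h2 := Spec.map_injective h1
  exact (congrArg (fun φ => φ.hom g) h2).symm

end Automorphisms

/-! ### Local structure of a finite flat covering -/

section Covering

variable {X Y : Scheme.{0}} [IsIntegral X] [IsIntegral Y] (π : Y ⟶ X) [IsDominant π]

lemma pullbackFunctions_algebraMap (y : Y) (f : X.presheaf.stalk (π y)) :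
    pullbackFunctions π (algebraMap (X.presheaf.stalk (π y)) X.functionField f) =
      algebraMap (Y.presheaf.stalk y) Y.functionField ((π.stalkMap y).hom f) := by
  obtain ⟨U, hU, g, rfl⟩ := X.presheaf.exists_germ_eq f
  have h := Scheme.Hom.germ_stalkMap_apply π U y hU g
  have h' : (π.stalkMap y).hom (X.presheaf.germ U (π y) hU g) =
    Y.presheaf.germ (π ⁻¹ᵁ U) y hU (π.app U g) := h
  rw [h', algebraMap_stalk_germ, pullbackFunctions_germ]
  exact (algebraMap_stalk_germ (U := π ⁻¹ᵁ U) hU _).symm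

lemma pullbackFunctions_mem (y : Y) {f : X.functionField} (hf : f ∈ localRing X (π y)) :
    pullbackFunctions π f ∈ localRing Y y := by
  obtain ⟨g, rfl⟩ := hf
  exact ⟨_, (pullbackFunctions_algebraMap π y g).symm⟩

/-- A dominant finite morphism has closed and dense range. -/
lemma surjective_of_isFinite {X Y : Scheme.{0}} (π : Y ⟶ X) [IsDominant π] [IsFinite π] :
    Function.Surjective π := by
  have : Surjective π := surjective_of_isDominant_of_isClosed_range π
    (π.isClosedMap.isClosed_range)
  exact π.surjective

/-- The function field extension of a finite covering is finite. -/
lemma finite_functionField [IsFinite π]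
    [Algebra.IsAlgebraic X.functionField (FunctionFieldOver π)] :
    Module.Finite X.functionField (FunctionFieldOver π) := by
  obtain ⟨_, ⟨U : X.Opens, hU, rfl⟩, hxU, -⟩ := X.isBasis_affineOpens.exists_subset_of_mem_open
    (Set.mem_univ (genericPoint X)) isOpen_univ
  have hgen : genericPoint Y ∈ π ⁻¹ᵁ U := genericPoint_mem_preimage π U hxU
  have : Nonempty (π ⁻¹ᵁ U) := ⟨⟨_, hgen⟩⟩
  have hfin : (π.app U).hom.Finite := IsFinite.finite_app π U hU
  let ψ : Γ(Y, π ⁻¹ᵁ U) →+* FunctionFieldOver π :=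
    (Y.presheaf.germ (π ⁻¹ᵁ U) (genericPoint Y) hgen).hom
  algebraize [(π.app U).hom]
  obtain ⟨s, hs⟩ := (Module.Finite.fg_top : (⊤ : Submodule Γ(X, U) Γ(Y, π ⁻¹ᵁ U)).FG)
  let E := IntermediateField.adjoin X.functionField (ψ '' (s : Set Γ(Y, π ⁻¹ᵁ U)))
  have hE : FiniteDimensional X.functionField E := by
    have : Finite (ψ '' (s : Set Γ(Y, π ⁻¹ᵁ U))) := (s.finite_toSet.image ψ).to_subtype
    exact IntermediateField.finiteDimensional_adjoin fun x _ =>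
      Algebra.IsIntegral.isIntegral x
  have hmem : ∀ b, ψ b ∈ E := by
    intro b
    have hb : b ∈ Submodule.span Γ(X, U) (s : Set Γ(Y, π ⁻¹ᵁ U)) := hs ▸ trivial
    induction hb using Submodule.span_induction with
    | mem x hx => exact IntermediateField.subset_adjoin _ _ ⟨x, hx, rfl⟩
    | zero => rw [map_zero]; exact zero_mem _
    | add x y _ _ hx hy => rw [map_add]; exact add_mem hx hy
    | smul a x _ hx =>
      rw [Algebra.smul_def, map_mul]
      refine mul_mem ?_ hx
      have : ψ (algebraMap Γ(X, U) Γ(Y, π ⁻¹ᵁ U) a) = algebraMap X.functionField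
          (FunctionFieldOver π) (X.presheaf.germ U (genericPoint X) hxU a) :=
        (pullbackFunctions_germ π U hxU a).symm
      rw [this]
      exact E.algebraMap_mem _
  have : IsFractionRing Γ(Y, π ⁻¹ᵁ U) Y.functionField :=
    functionField_isFractionRing_of_isAffineOpen Y _ (hU.preimage π)
  have htop : E = ⊤ := by
    refine eq_top_iff.2 fun z _ => ?_
    obtain ⟨a, b, -, h⟩ := IsFractionRing.div_surjective (A := Γ(Y, π ⁻¹ᵁ U))
      (K := Y.functionField) z
    have h' : z = ψ a / ψ b := h.symm
    rw [h']
    exact div_mem (hmem a) (hmem b)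
  rw [htop] at hE
  exact Module.Finite.equiv
    (IntermediateField.topEquiv (F := X.functionField) (E := FunctionFieldOver π)).toLinearEquiv

/-- A finite flat covering maps points of codimension one to points of codimension one: the
codimension does not increase by going down, and if `y` mapped to the generic point of `X`, then
the local ring at `y` would be a field, being a ring between `ℂ(X)` and its algebraic extension
`ℂ(Y)`. -/
lemma coheight_apply_eq_one [IsLocallyNoetherian X] [IsLocallyNoetherian Y] [Flat π]
    [Algebra.IsAlgebraic X.functionField (FunctionFieldOver π)] {y : Y}
    (hy : Order.coheight y = 1) : Order.coheight (π y) = 1 := by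
  have hle : Order.coheight (π y) ≤ 1 := by
    have hflat := Flat.stalkMap π y
    algebraize [(π.stalkMap y).hom]
    have hlo : (IsLocalRing.maximalIdeal (Y.presheaf.stalk y)).LiesOver
        (IsLocalRing.maximalIdeal (X.presheaf.stalk (π y))) :=
      ⟨(((IsLocalRing.local_hom_TFAE (π.stalkMap y).hom).out 0 4 :
        IsLocalHom (π.stalkMap y).hom ↔ (IsLocalRing.maximalIdeal (Y.presheaf.stalk y)).comap
          (π.stalkMap y).hom = IsLocalRing.maximalIdeal (X.presheaf.stalk (π y))).1
            inferInstance).symm⟩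
    have h1 := Ideal.height_eq_height_add_of_liesOver_of_hasGoingDown
      (IsLocalRing.maximalIdeal (X.presheaf.stalk (π y)))
      (IsLocalRing.maximalIdeal (Y.presheaf.stalk y))
    have h2 : (IsLocalRing.maximalIdeal (X.presheaf.stalk (π y))).height =
        Order.coheight (π y) := by
      have := IsLocalRing.maximalIdeal_height_eq_ringKrullDim (R := X.presheaf.stalk (π y))
      rw [ringKrullDim_stalk_eq_coheight] at this
      exact_mod_cast this
    have h3 : (IsLocalRing.maximalIdeal (Y.presheaf.stalk y)).height = Order.coheight y := by
      have := IsLocalRing.maximalIdeal_height_eq_ringKrullDim (R := Y.presheaf.stalk y)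
      rw [ringKrullDim_stalk_eq_coheight] at this
      exact_mod_cast this
    rw [← h2, ← hy, ← h3, h1]
    exact le_self_add
  refine le_antisymm hle ?_
  rw [Order.one_le_iff_ne_zero]
  intro h0
  have hmax : IsMax (π y) := Order.coheight_eq_zero.1 h0
  have hgen : π y = genericPoint X := by
    have h1 : genericPoint X ⤳ π y := (genericPoint_spec X).specializes trivial
    have h2 : π y ⤳ genericPoint X := hmax h1
    exact (h2.antisymm h1).eq
  have htop : localRing X (π y) = ⊤ := hgen ▸ localRing_genericPoint
  let S : Subalgebra X.functionField (FunctionFieldOver π) :=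
    { (localRing Y y).toSubsemiring with
      algebraMap_mem' := fun c => pullbackFunctions_mem π y (htop ▸ trivial) }
  have hfield : IsField (Y.presheaf.stalk y) := by
    refine ⟨exists_pair_ne _, mul_comm, fun {a} ha => ?_⟩
    have h1 : (algebraMap (Y.presheaf.stalk y) Y.functionField a)⁻¹ ∈ S :=
      S.inv_mem_of_algebraic (x := ⟨algebraMap (Y.presheaf.stalk y) Y.functionField a, a, rfl⟩)
        (Algebra.IsAlgebraic.isAlgebraic _)
    obtain ⟨b, hb⟩ := (isUnit_stalk_iff ha).2 h1
    exact ⟨(↑b⁻¹ : Y.presheaf.stalk y), by rw [← hb, Units.mul_inv]⟩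
  have h1 := ringKrullDim_eq_zero_of_isField hfield
  rw [ringKrullDim_stalk_eq_coheight, hy] at h1
  exact one_ne_zero (α := ℕ∞) (by exact_mod_cast h1)

variable [IsLocallyNoetherian X] [IsLocallyNoetherian Y]

/-- Pulling back a rational function multiplies its order by the ramification index. -/
lemma ord_pullbackFunctions (Q : PrimeDivisor Y)
    [IsDiscreteValuationRing (X.presheaf.stalk (π Q.point))]
    [IsDiscreteValuationRing (Y.presheaf.stalk Q.point)]
    (hP : Order.coheight (π Q.point) = 1) {f : X.functionField} (hf : f ≠ 0) :
    Scheme.ord (pullbackFunctions π f) Q.point =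
      ramificationIndex π Q * Scheme.ord f (π Q.point) := by
  have hQ := Q.codim_one
  obtain ⟨ϖ, hϖ⟩ := IsDiscreteValuationRing.exists_irreducible (X.presheaf.stalk (π Q.point))
  set z := algebraMap (X.presheaf.stalk (π Q.point)) X.functionField ϖ with hz
  have hz0 : z ≠ 0 := by
    rw [hz, Ne, map_eq_zero_iff _ (algebraMap_stalk_injective _)]
    exact hϖ.ne_zero
  have hpz0 : pullbackFunctions π z ≠ 0 := (map_ne_zero _).2 hz0
  have hordz : Scheme.ord (pullbackFunctions π z) Q.point = ramificationIndex π Q := by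
    have h1 : pullbackFunctions π z = algebraMap _ _ ((π.stalkMap Q.point).hom ϖ) :=
      pullbackFunctions_algebraMap π Q.point ϖ
    have h2 : (π.stalkMap Q.point).hom ϖ ≠ 0 := by
      intro h
      rw [h, map_zero] at h1
      exact hpz0 h1
    rw [h1, ord_algebraMap_eq_length hQ h2, ramificationIndex, hϖ.maximalIdeal_eq,
      Ideal.map_span, Set.image_singleton]
  have hunit : ∀ u : X.functionField, u ≠ 0 → Scheme.ord u (π Q.point) = 0 →
      0 ≤ Scheme.ord (pullbackFunctions π u) Q.point := by
    intro u hu h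
    rw [← mem_localRing_iff_ord hQ ((map_ne_zero _).2 hu)]
    exact pullbackFunctions_mem π _ ((mem_localRing_iff_ord hP hu).2 h.ge)
  -- `f` is a unit at `P` times the `n`-th power of a uniformizer
  set n := Scheme.ord f (π Q.point) with hn
  have hu0 : f * z ^ (-n) ≠ 0 := mul_ne_zero hf (zpow_ne_zero _ hz0)
  have hu : Scheme.ord (f * z ^ (-n)) (π Q.point) = 0 := by
    rw [Scheme.ord_mul hf (zpow_ne_zero _ hz0), ord_zpow_eq hP hz0, ord_irreducible hP hϖ]
    omega
  have h1 := hunit _ hu0 hu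
  have h2 := hunit _ (inv_ne_zero hu0) (by rw [ord_inv_eq hP hu0, hu, neg_zero])
  rw [map_inv₀, ord_inv_eq hQ ((map_ne_zero _).2 hu0)] at h2
  rw [map_mul, map_zpow₀, Scheme.ord_mul ((map_ne_zero _).2 hf) (zpow_ne_zero _ hpz0),
    ord_zpow_eq hQ hpz0, hordz] at h1 h2
  linarith

end Covering

/-! ### Coherent sheaves of vector fields -/

section Sheaves

variable {X : Scheme.{0}} [IsIntegral X] {V : Type} [AddCommGroup V] [Module X.functionField V]

/-- All stalks of a coherent sheaf span the same space: near a given point they are generated by the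
same elements, and every neighbourhood contains the generic point. -/
lemma span_stalk_eq_genericStalk {E : StalkFamily X V} (hE : IsCoherent E) (x : X) :
    Submodule.span X.functionField (E x : Set V) = genericStalk E := by
  have key : ∀ x, Submodule.span X.functionField (E x : Set V) =
      Submodule.span X.functionField (E (genericPoint X) : Set V) := by
    intro x
    obtain ⟨U, hx, s, hs⟩ := hE x
    have h : ∀ y ∈ U, Submodule.span X.functionField (E y : Set V) =
        Submodule.span X.functionField (s : Set V) := by
      intro y hy
      rw [hs y hy]
      refine le_antisymm (Submodule.span_le.2 fun v hv => ?_)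
        (Submodule.span_mono Submodule.subset_span)
      induction hv using Submodule.span_induction with
      | mem v hv => exact Submodule.subset_span hv
      | zero => exact zero_mem _
      | add v w _ _ hv hw => exact add_mem hv hw
      | smul c v _ hv => exact Submodule.smul_mem _ (c : X.functionField) hv
    rw [h x hx, h _ (genericPoint_mem_of_mem hx)]
  refine le_antisymm (Submodule.span_mono (Set.subset_iUnion (fun y => (E y : Set V)) x))
    (Submodule.span_le.2 (Set.iUnion_subset fun y => ?_))
  rw [key x, ← key y]
  exact Submodule.subset_span

lemma exists_smul_mem_of_mem_span {x : X} (N : Submodule (localRing X x) V) {v : V}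
    (hv : v ∈ Submodule.span X.functionField (N : Set V)) :
    ∃ g : localRing X x, g ≠ 0 ∧ g • v ∈ N := by
  induction hv using Submodule.span_induction with
  | mem v hv => exact ⟨1, one_ne_zero, by simpa using hv⟩
  | zero => exact ⟨1, one_ne_zero, by simp⟩
  | add v w _ _ hv hw =>
    obtain ⟨g, hg, hgv⟩ := hv
    obtain ⟨h, hh, hhw⟩ := hw
    refine ⟨g * h, mul_ne_zero hg hh, ?_⟩
    rw [smul_add]
    refine add_mem ?_ ?_
    · rw [mul_comm, mul_smul]; exact N.smul_mem _ hgv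
    · rw [mul_smul]; exact N.smul_mem _ hhw
  | smul c v _ hv =>
    obtain ⟨g, hg, hgv⟩ := hv
    obtain ⟨a, b, hb, rfl⟩ := IsFractionRing.div_surjective (A := localRing X x) c
    have hb0 : b ≠ 0 := nonZeroDivisors.ne_zero hb
    refine ⟨b * g, mul_ne_zero hb0 hg, ?_⟩
    have hb1 : (algebraMap (localRing X x) X.functionField b) ≠ 0 := by
      simpa using hb0
    have : (b * g) • (algebraMap (localRing X x) X.functionField a /
        algebraMap (localRing X x) X.functionField b) • v = a • g • v := by
      simp only [Subring.smul_def, smul_smul]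
      congr 1
      have h1 : algebraMap (localRing X x) X.functionField a = a := rfl
      have h2 : algebraMap (localRing X x) X.functionField b = b := rfl
      rw [h2] at hb1
      rw [h1, h2]
      push_cast
      field_simp
    rw [this]
    exact N.smul_mem _ hgv

lemma exists_smul_mem_stalk {E : StalkFamily X V} (hE : IsCoherent E) (x : X) {v : V}
    (hv : v ∈ genericStalk E) : ∃ g : localRing X x, g ≠ 0 ∧ g • v ∈ E x :=
  exists_smul_mem_of_mem_span _ (by rwa [span_stalk_eq_genericStalk hE])

end Sheaves

section Derivations

variable {K M : Type} [Field K] [Algebra ℂ K] [AddCommGroup M] [Module K M] [Module ℂ M]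


lemma derivation_ext_of_adjoin {s : Set K}
    (hs : ∀ f : K, ∃ a ∈ Algebra.adjoin ℂ s, ∃ b ∈ Algebra.adjoin ℂ s, b ≠ 0 ∧ f = a * b⁻¹)
    {v w : Derivation ℂ K M} (h : ∀ a ∈ s, v a = w a) : v = w := by
  have h1 : Set.EqOn v w (Algebra.adjoin ℂ s) := Derivation.eqOn_adjoin h
  ext f
  obtain ⟨a, ha, b, hb, hb0, rfl⟩ := hs f
  rw [Derivation.leibniz, Derivation.leibniz, Derivation.leibniz_inv, Derivation.leibniz_inv,
    h1 ha, h1 hb]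

lemma derivation_mem_of_adjoin {s : Set K} {R : Subring K} (v : Derivation ℂ K K)
    (hR : ∀ a ∈ Algebra.adjoin ℂ s, a ∈ R) (h : ∀ a ∈ s, v a ∈ R) :
    ∀ a ∈ Algebra.adjoin ℂ s, v a ∈ R := by
  intro a ha
  induction ha using Algebra.adjoin_induction with
  | mem a ha => exact h a ha
  | algebraMap r => rw [Derivation.map_algebraMap]; exact zero_mem _
  | add a b _ _ ha hb => rw [map_add]; exact add_mem ha hb
  | mul a b ha' hb' ha hb =>
    rw [Derivation.leibniz]
    exact add_mem (mul_mem (hR _ ha') hb) (mul_mem (hR _ hb') ha)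

/-- A derivation that maps a ring `A` into a localization `R` of `A` preserves `R`. -/
lemma derivation_mem_of_localization {A : Set K} {R : Subring K} (v : Derivation ℂ K K)
    (hA : ∀ a ∈ A, a ∈ R) (h : ∀ a ∈ A, v a ∈ R)
    (hR : ∀ f ∈ R, ∃ a ∈ A, ∃ b ∈ A, b ≠ 0 ∧ b⁻¹ ∈ R ∧ f = a * b⁻¹) :
    ∀ f ∈ R, v f ∈ R := by
  intro f hf
  obtain ⟨a, ha, b, hb, hb0, hb1, rfl⟩ := hR f hf
  rw [Derivation.leibniz, Derivation.leibniz_inv]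
  refine add_mem (mul_mem (hA _ ha) ?_) (mul_mem hb1 (h _ ha))
  rw [neg_smul, ← smul_neg]
  exact mul_mem (pow_mem hb1 _) (neg_mem (h _ hb))

end Derivations

section VectorFields

variable {X : Scheme.{0}} [IsIntegral X] [X.Over SpecC]

/-- The vector fields that lie in a given subspace of the space of rational vector fields. -/
def vectorFieldsIn (W : Submodule X.functionField (RationalVectorField X)) :
    StalkFamily X (RationalVectorField X) := fun x =>
  tangentSheaf X x ⊓
    { carrier := W
      zero_mem' := W.zero_mem
      add_mem' := W.add_mem
      smul_mem' := fun c _ hv => W.smul_mem (c : X.functionField) hv }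

lemma mem_vectorFieldsIn {W : Submodule X.functionField (RationalVectorField X)} {x : X}
    {v : RationalVectorField X} :
    v ∈ vectorFieldsIn W x ↔ (∀ f ∈ localRing X x, v f ∈ localRing X x) ∧ v ∈ W := Iff.rfl

lemma vectorFieldsIn_saturated (W : Submodule X.functionField (RationalVectorField X)) :
    IsSaturatedIn (vectorFieldsIn W) (tangentSheaf X) := by
  refine fun x => ⟨inf_le_left, fun v hv g hg hgv => ⟨hv, ?_⟩⟩
  have hg' : (g : X.functionField) ≠ 0 := by simpa using hg
  exact (W.smul_mem_iff hg').1 (show (g : X.functionField) • v ∈ W from hgv.2)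

/-- At the generic point of `X` every rational vector field is regular. -/
lemma genericStalk_vectorFieldsIn (W : Submodule X.functionField (RationalVectorField X)) :
    genericStalk (vectorFieldsIn W) = W := by
  refine le_antisymm (Submodule.span_le.2 (Set.iUnion_subset fun x v hv => hv.2)) fun v hv => ?_
  exact mem_genericStalk (x := genericPoint X) _
    ⟨fun f _ => by rw [localRing_genericPoint]; trivial, hv⟩

variable [LocallyOfFiniteType (X ↘ SpecC)]

/-- A derivation of the function field is determined by its values at the generators of a chart. -/
instance finite_rationalVectorField :
    Module.Finite X.functionField (RationalVectorField X) := by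
  obtain ⟨U, A, hx, ⟨s, rfl⟩, hA⟩ := exists_chart (genericPoint X)
  let ev : RationalVectorField X →ₗ[X.functionField] (s → X.functionField) :=
    { toFun := fun v a => v a
      map_add' := fun v w => rfl
      map_smul' := fun c v => rfl }
  refine Module.Finite.of_injective ev fun v w h => ?_
  refine derivation_ext_of_adjoin (s := s) (fun f => ?_) fun a ha => congrFun h ⟨a, ha⟩
  obtain ⟨a, ha, b, hb, hb0, -, h⟩ := (hA _ hx).2 f (by rw [localRing_genericPoint]; trivial)
  exact ⟨a, ha, b, hb, hb0, h⟩

/-- On a chart with coordinate ring `A`, the elements of `W` that preserve `A` form a finitely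
generated `A`-module, since evaluation at the generators of `A` embeds it in a free module; its
localizations are the stalks. -/
lemma vectorFieldsIn_coherent (W : Submodule X.functionField (RationalVectorField X)) :
    IsCoherent (vectorFieldsIn W) := by
  classical
  intro x
  obtain ⟨U, A, hx, hfg, hA⟩ := exists_chart x
  have hnoeth : IsNoetherianRing A := by
    have : Algebra.FiniteType ℂ A := A.fg_iff_finiteType.1 hfg
    exact Algebra.FiniteType.isNoetherianRing ℂ A
  obtain ⟨s, rfl⟩ := hfg
  set A := Algebra.adjoin ℂ (s : Set X.functionField) with hAdef
  -- the vector fields in `W` that are regular on the chart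
  let D : Submodule A (RationalVectorField X) :=
    { carrier := {v | v ∈ W ∧ ∀ a ∈ A, v a ∈ A}
      zero_mem' := ⟨W.zero_mem, fun a _ => zero_mem A⟩
      add_mem' := fun hv hw => ⟨W.add_mem hv.1 hw.1, fun a ha => add_mem (hv.2 a ha) (hw.2 a ha)⟩
      smul_mem' := fun c v hv => ⟨W.smul_mem (c : X.functionField) hv.1,
        fun a ha => mul_mem c.2 (hv.2 a ha)⟩ }
  have hgen : ∀ f : X.functionField, ∃ a ∈ A, ∃ b ∈ A, b ≠ 0 ∧ f = a * b⁻¹ := by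
    intro f
    obtain ⟨a, ha, b, hb, hb0, -, h⟩ :=
      (hA _ (genericPoint_mem_of_mem hx)).2 f (by rw [localRing_genericPoint]; trivial)
    exact ⟨a, ha, b, hb, hb0, h⟩
  let ev : D →ₗ[A] (s → A) :=
    { toFun := fun v a => ⟨(v : RationalVectorField X) a,
        v.2.2 _ (Algebra.subset_adjoin a.2)⟩
      map_add' := fun v w => rfl
      map_smul' := fun c v => rfl }
  have hev : Function.Injective ev := fun v w h =>
    Subtype.ext (derivation_ext_of_adjoin hgen fun a ha =>
      congrArg Subtype.val (congrFun h ⟨a, ha⟩))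
  have : IsNoetherian A D := isNoetherian_of_injective ev hev
  obtain ⟨G, hG⟩ := (D.fg_top).1 (IsNoetherian.noetherian (⊤ : Submodule A D))
  refine ⟨U, hx, G, fun y hy => le_antisymm (fun v hv => ?_) (Submodule.span_le.2 fun v hv => ?_)⟩
  · obtain ⟨hvT, hvW⟩ := mem_vectorFieldsIn.1 hv
    have hden : ∀ t : Finset X.functionField, t ⊆ s → ∃ d ∈ A, d ≠ 0 ∧ d⁻¹ ∈ localRing X y ∧
        ∀ a ∈ t, d * v a ∈ A := by
      intro t
      induction t using Finset.induction_on with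
      | empty => exact fun _ => ⟨1, one_mem _, one_ne_zero, by simp, by simp⟩
      | insert a t _ ih =>
        intro hts
        obtain ⟨d, hd, hd0, hd1, hdt⟩ := ih ((Finset.subset_insert a t).trans hts)
        have has : a ∈ A := Algebra.subset_adjoin (hts (Finset.mem_insert_self a t))
        obtain ⟨p, hp, q, hq, hq0, hq1, hpq⟩ := (hA y hy).2 _ (hvT a ((hA y hy).1 a has))
        refine ⟨d * q, mul_mem hd hq, mul_ne_zero hd0 hq0, ?_, ?_⟩
        · rw [mul_inv]; exact mul_mem hd1 hq1
        · intro b hb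
          rcases Finset.mem_insert.1 hb with rfl | hb
          · have : d * q * v b = d * p := by rw [hpq]; field_simp
            rw [this]; exact mul_mem hd hp
          · have : d * q * v b = q * (d * v b) := by ring
            rw [this]; exact mul_mem hq (hdt b hb)
    obtain ⟨d, hd, hd0, hd1, hds⟩ := hden s subset_rfl
    have hdv : d • v ∈ D := by
      refine ⟨W.smul_mem d hvW, fun a ha => ?_⟩
      exact derivation_mem_of_adjoin (R := A.toSubring) (d • v) (fun a ha => ha) hds a ha
    have hspan : ∀ w ∈ Submodule.span A (G : Set (RationalVectorField X)),
        w ∈ Submodule.span (localRing X y) (G : Set (RationalVectorField X)) := by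
      intro w hw
      induction hw using Submodule.span_induction with
      | mem w hw => exact Submodule.subset_span hw
      | zero => exact zero_mem _
      | add w w' _ _ h h' => exact add_mem h h'
      | smul c w _ h =>
        exact Submodule.smul_mem _ (⟨c, (hA y hy).1 _ c.2⟩ : localRing X y) h
    have h1 := Submodule.smul_mem _ (⟨d⁻¹, hd1⟩ : localRing X y) (hspan _ (hG ▸ hdv))
    have h2 : (⟨d⁻¹, hd1⟩ : localRing X y) • d • v = v := by
      rw [Subring.smul_def, smul_smul, inv_mul_cancel₀ hd0, one_smul]
    rwa [h2] at h1
  · have hvD : v ∈ D := hG ▸ Submodule.subset_span hv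
    exact ⟨derivation_mem_of_localization (A := A) v (hA y hy).1
      (fun a ha => (hA y hy).1 _ (hvD.2 a ha)) (hA y hy).2, hvD.1⟩

end VectorFields

/-! ### Galois descent of subspaces of vector fields -/

section Trace

variable (K L : Type) [Field K] [Field L] [Algebra K L] [Module.Finite K L]
  [Algebra.IsSeparable K L]

/-- The dual basis for the trace form expresses an element through traces. -/
lemma exists_trace_decomposition : ∃ (n : ℕ) (b c : Fin n → L), ∀ z : L,
    z = ∑ i, b i * algebraMap K L (Algebra.trace K L (c i * z)) := by
  classical
  let b := Module.finBasis K L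
  refine ⟨_, b, b.traceDual, fun z => ?_⟩
  conv_lhs => rw [← b.sum_repr z]
  refine Finset.sum_congr rfl fun i _ => ?_
  have h3 := b.traceDual.traceDual_repr_apply z i
  rw [Module.Basis.traceDual_traceDual, Algebra.traceForm_apply] at h3
  rw [h3, Algebra.smul_def, mul_comm, mul_comm z]

variable {K L}

lemma eq_zero_of_trace_mul_eq_zero {l : L} (h : ∀ e, Algebra.trace K L (e * l) = 0) : l = 0 :=
  (traceForm_nondegenerate K L).2 l h

end Trace

section Descent

variable {X Y : Scheme.{0}} [IsIntegral X] [IsIntegral Y] [X.Over SpecC]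
  (π : Y ⟶ X) [IsDominant π]

lemma pullbackVectorField_apply (v : RationalVectorField X) (f : X.functionField) :
    pullbackVectorField π v f = algebraMap X.functionField (FunctionFieldOver π) (v f) := rfl

lemma pullbackVectorField_add (v w : RationalVectorField X) :
    pullbackVectorField π (v + w) = pullbackVectorField π v + pullbackVectorField π w := by
  ext f
  exact map_add (algebraMap X.functionField (FunctionFieldOver π)) _ _

lemma pullbackVectorField_zero : pullbackVectorField π 0 = 0 := by
  ext f
  exact map_zero (algebraMap X.functionField (FunctionFieldOver π))

lemma pullbackVectorField_smul (c : X.functionField) (v : RationalVectorField X) :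
    pullbackVectorField π (c • v) = pullbackFunctions π c • pullbackVectorField π v := by
  ext f
  exact map_mul (algebraMap X.functionField (FunctionFieldOver π)) _ _

lemma pullbackVectorField_sum {ι : Type*} (s : Finset ι) (v : ι → RationalVectorField X) :
    pullbackVectorField π (∑ i ∈ s, v i) = ∑ i ∈ s, pullbackVectorField π (v i) :=
  map_sum (⟨⟨pullbackVectorField π, pullbackVectorField_zero π⟩, pullbackVectorField_add π⟩ :
    RationalVectorField X →+ PullbackVectorField π) _ _

/-- The rational vector fields on `X` whose pullback lies in `W`. -/
def descendedFields (W : Submodule Y.functionField (PullbackVectorField π)) :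
    Submodule X.functionField (RationalVectorField X) where
  carrier := {v | pullbackVectorField π v ∈ W}
  zero_mem' := by
    rw [Set.mem_ofPred_eq, pullbackVectorField_zero]; exact zero_mem _
  add_mem' := fun hv hw => by
    rw [Set.mem_ofPred_eq, pullbackVectorField_add]; exact add_mem hv hw
  smul_mem' := fun c v hv => by
    rw [Set.mem_ofPred_eq, pullbackVectorField_smul]; exact W.smul_mem _ hv

/-- The vector field `f ↦ Tr (e * v f)` on `X`. -/
def traceField (e : FunctionFieldOver π) (v : PullbackVectorField π) : RationalVectorField X :=
  ((Algebra.trace X.functionField (FunctionFieldOver π)).comp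
    (LinearMap.mulLeft X.functionField e)).compDer v

lemma traceField_apply (e : FunctionFieldOver π) (v : PullbackVectorField π)
    (f : X.functionField) :
    traceField π e v f = Algebra.trace X.functionField (FunctionFieldOver π) (e * v f) := rfl

lemma traceField_sum_smul {ι : Type*} (s : Finset ι) (e : FunctionFieldOver π)
    (l : ι → Y.functionField) (u : ι → RationalVectorField X) :
    traceField π e (∑ i ∈ s, l i • pullbackVectorField π (u i)) =
      ∑ i ∈ s, Algebra.trace X.functionField (FunctionFieldOver π)
        (e * (toFunctionField π).symm (l i)) • u i := by
  ext f
  rw [traceField_apply, ← Derivation.coeFnAddMonoidHom_apply, map_sum,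
    ← Derivation.coeFnAddMonoidHom_apply, map_sum, Finset.sum_apply, Finset.sum_apply,
    Finset.mul_sum, map_sum]
  refine Finset.sum_congr rfl fun i _ => ?_
  have : e * (l i • pullbackVectorField π (u i)) f =
      (u i f) • (e * (toFunctionField π).symm (l i)) := by
    rw [Algebra.smul_def, mul_comm, mul_comm e, ← mul_assoc]
    congr 1
    exact mul_comm (G := FunctionFieldOver π) _ _
  exact (congrArg _ this).trans (by rw [map_smul]; exact mul_comm _ _)

variable [Module.Finite X.functionField (FunctionFieldOver π)]

section Separable

variable [Algebra.IsSeparable X.functionField (FunctionFieldOver π)]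

/-- A vector field is recovered from its traces. -/
lemma mem_span_traceField (v : PullbackVectorField π) :
    v ∈ Submodule.span Y.functionField
      (Set.range fun e => pullbackVectorField π (traceField π e v)) := by
  obtain ⟨n, b, c, h⟩ := exists_trace_decomposition X.functionField (FunctionFieldOver π)
  have h : v = ∑ i, toFunctionField π (b i) • pullbackVectorField π (traceField π (c i) v) := by
    ext f
    rw [← Derivation.coeFnAddMonoidHom_apply (∑ i, _), map_sum, Finset.sum_apply]
    exact h (v f)
  exact Set.mem_of_eq_of_mem h (Submodule.sum_mem _ fun i _ => Submodule.smul_mem _ _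
    (Submodule.subset_span (Set.mem_range_self (c i))))

/-- Taking traces turns a relation over `ℂ(Y)` into relations over `ℂ(X)`. -/
lemma linearIndependent_pullbackVectorField {ι : Type*} {u : ι → RationalVectorField X}
    (hu : LinearIndependent X.functionField u) :
    LinearIndependent Y.functionField (fun i => pullbackVectorField π (u i)) := by
  rw [linearIndependent_iff']
  intro s g h i hi
  have h1 : ∀ e : FunctionFieldOver π, Algebra.trace X.functionField (FunctionFieldOver π)
      (e * (toFunctionField π).symm (g i)) = 0 := by
    intro e
    have h2 := traceField_sum_smul π s e g u
    rw [h] at h2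
    have h3 : traceField π e 0 = 0 := by
      ext f
      rw [traceField_apply]
      simp
    exact linearIndependent_iff'.1 hu s _ (h2.symm.trans h3) i hi
  exact (toFunctionField π).symm.map_eq_zero_iff.1
    (eq_zero_of_trace_mul_eq_zero (K := X.functionField) h1)

end Separable

variable [IsGalois X.functionField (FunctionFieldOver π)]

/-- The subspace `W` is stable under the Galois group of the function field extension. -/
def IsStableSubspace (W : Submodule Y.functionField (PullbackVectorField π)) : Prop :=
  ∀ σ : FunctionFieldOver π ≃ₐ[X.functionField] FunctionFieldOver π, ∀ v ∈ W,
    σ.toLinearMap.compDer v ∈ W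

variable {W : Submodule Y.functionField (PullbackVectorField π)}

lemma traceField_mem (hW : IsStableSubspace π W) {v : PullbackVectorField π} (hv : v ∈ W)
    (e : FunctionFieldOver π) : traceField π e v ∈ descendedFields π W := by
  change pullbackVectorField π (traceField π e v) ∈ W
  have h : pullbackVectorField π (traceField π e v) =
      ∑ σ : FunctionFieldOver π ≃ₐ[X.functionField] FunctionFieldOver π,
        σ.toLinearMap.compDer (toFunctionField π e • v) := by
    ext f
    rw [pullbackVectorField_apply, traceField_apply, trace_eq_sum_automorphisms,
      ← Derivation.coeFnAddMonoidHom_apply (∑ i, _), map_sum, Finset.sum_apply]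
    rfl
  rw [h]
  exact Submodule.sum_mem _ fun σ _ => hW σ _ (W.smul_mem _ hv)

/-- Galois descent: a stable subspace is generated by the vector fields on `X` it contains. -/
lemma span_descendedFields (hW : IsStableSubspace π W) :
    Submodule.span Y.functionField
      (pullbackVectorField π '' (descendedFields π W : Set (RationalVectorField X))) = W := by
  refine le_antisymm (Submodule.span_le.2 ?_) fun v hv => ?_
  · rintro _ ⟨v, hv, rfl⟩
    exact hv
  · refine Submodule.span_mono ?_ (mem_span_traceField π v)
    rintro _ ⟨e, rfl⟩
    exact ⟨_, traceField_mem π hW hv e, rfl⟩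

/-- Functionals that vanish on the descended subspace, applied to the coefficients of an element of
a stable subspace. -/
lemma sum_mul_functional_eq_zero (hW : IsStableSubspace π W) {ι : Type*} (s : Finset ι)
    (l : ι → Y.functionField) (u : ι → RationalVectorField X)
    (hl : ∑ i ∈ s, l i • pullbackVectorField π (u i) ∈ W)
    (φ : Module.Dual X.functionField (RationalVectorField X))
    (hφ : ∀ w ∈ descendedFields π W, φ w = 0) :
    ∑ i ∈ s, l i * pullbackFunctions π (φ (u i)) = 0 := by
  have h : (∑ i ∈ s, φ (u i) • (toFunctionField π).symm (l i) : FunctionFieldOver π) = 0 := by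
    refine eq_zero_of_trace_mul_eq_zero (K := X.functionField) fun e => ?_
    have h1 := hφ _ (traceField_mem π hW hl e)
    rw [traceField_sum_smul, map_sum] at h1
    rw [Finset.mul_sum, map_sum, ← h1]
    refine Finset.sum_congr rfl fun i _ => ?_
    rw [mul_smul_comm, map_smul, map_smul, smul_eq_mul, smul_eq_mul, mul_comm]
  refine Eq.trans (Finset.sum_congr rfl fun i _ => ?_) h
  rw [Algebra.smul_def]
  exact mul_comm _ _

/-- Descent of integral structures along a flat local homomorphism: a combination of pulled back
vector fields that lies in a stable subspace is a combination of pulled back vector fields on `X`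
that lie in the descended subspace. The equational criterion of flatness is applied to the
relations obtained from the functionals vanishing on the descended subspace. -/
lemma mem_pullbackSheaf_vectorFieldsIn [IsLocallyNoetherian X] [Flat π]
    (hW : IsStableSubspace π W) (y : Y) {v : PullbackVectorField π} (hvW : v ∈ W)
    (hv : v ∈ pullbackSheaf π (tangentSheaf X) y) :
    v ∈ pullbackSheaf π (vectorFieldsIn (descendedFields π W)) y := by
  classical
  obtain ⟨n, g', m', hm'⟩ := Submodule.mem_span_set'.1 hv
  choose m hmT hm using fun i => (m' i).2
  let R := X.presheaf.stalk (π y)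
  let S := Y.presheaf.stalk y
  have hflat := Flat.stalkMap π y
  algebraize [(π.stalkMap y).hom]
  choose g hg using fun i => (g' i).2
  have hv' : v = ∑ i, algebraMap S Y.functionField (g i) • pullbackVectorField π (m i) := by
    rw [← hm']
    refine Finset.sum_congr rfl fun i _ => ?_
    rw [hg, hm]
    rfl
  -- all `R`-linear relations between the coefficients `g i` are used
  let x : (Fin n → R) →ₗ[R] S := Fintype.linearCombination R g
  have hx : x ∘ₗ (LinearMap.ker x).subtype = 0 := LinearMap.ext fun r => r.2
  obtain ⟨κ, a, z, hz, ha⟩ := Module.Flat.exists_factorization_of_comp_eq_zero_of_free hx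
  let c : Fin n → Fin κ → R := fun i l => a (Pi.single i 1) l
  have hgc : ∀ i, g i = ∑ l, (π.stalkMap y).hom (c i l) * z (Finsupp.single l 1) := by
    intro i
    have h1 : g i = x (Pi.single i 1) := by
      simp [x, Fintype.linearCombination_apply_single]
    rw [h1, hz, LinearMap.comp_apply]
    conv_lhs => rw [← Finsupp.univ_sum_single (a (Pi.single i 1)), map_sum]
    refine Finset.sum_congr rfl fun l _ => ?_
    rw [← mul_one (a (Pi.single i 1) l), ← smul_eq_mul, ← Finsupp.smul_single, map_smul,
      Algebra.smul_def]
    rfl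
  let w : Fin κ → RationalVectorField X := fun l =>
    ∑ i, algebraMap R X.functionField (c i l) • m i
  have hwT : ∀ l, w l ∈ tangentSheaf X (π y) := fun l =>
    Submodule.sum_mem _ fun i _ =>
      Submodule.smul_mem _ (⟨algebraMap R X.functionField (c i l), _, rfl⟩ :
        localRing X (π y)) (hmT i)
  have hwW : ∀ l, w l ∈ descendedFields π W := by
    intro l
    -- a functional separating `w l` from the descended subspace gives a relation between the `g i`,
    -- which the matrix `c` satisfies as well
    by_contra hl
    obtain ⟨φ, hφ1, hφ2⟩ := Submodule.exists_le_ker_of_notMem hl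
    have h1 := sum_mul_functional_eq_zero π hW Finset.univ _ m (hv' ▸ hvW) φ fun w hw => hφ2 hw
    obtain ⟨d, hd⟩ := IsLocalization.exist_integer_multiples (nonZeroDivisors R) Finset.univ
      (fun i => φ (m i))
    choose r hr using fun i => hd i (Finset.mem_univ i)
    have hd0 : algebraMap R X.functionField d ≠ 0 := by
      rw [Ne, map_eq_zero_iff _ (algebraMap_stalk_injective _)]
      exact nonZeroDivisors.ne_zero d.2
    have hker : r ∈ LinearMap.ker x := by
      rw [LinearMap.mem_ker]
      refine algebraMap_stalk_injective y ?_
      rw [map_zero, Fintype.linearCombination_apply, map_sum]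
      have h2 : ∑ i, pullbackFunctions π (algebraMap R X.functionField d) *
          (algebraMap S Y.functionField (g i) * pullbackFunctions π (φ (m i))) = 0 := by
        rw [← Finset.mul_sum, h1, mul_zero]
      rw [← h2]
      refine Finset.sum_congr rfl fun i _ => ?_
      rw [Algebra.smul_def, map_mul]
      have h3 : algebraMap S Y.functionField (algebraMap R S (r i)) =
          pullbackFunctions π (algebraMap R X.functionField (r i)) :=
        (pullbackFunctions_algebraMap π y _).symm
      have h4 : algebraMap R X.functionField (r i) = algebraMap R X.functionField d * φ (m i) := by
        rw [hr i]
        exact Algebra.smul_def _ _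
      rw [h3, h4, map_mul]
      ring
    have h5 : a r = 0 := LinearMap.congr_fun ha ⟨r, hker⟩
    have h6 : ∑ i, r i * c i l = 0 := by
      have h7 : r = ∑ i, r i • Pi.single (M := fun _ => R) i 1 := by
        ext j
        simp [Finset.sum_apply, Pi.single_apply]
      rw [h7, map_sum] at h5
      have h8 := DFunLike.congr_fun h5 l
      rw [Finsupp.finsetSum_apply] at h8
      simpa [c] using h8
    refine hφ1 ?_
    have h9 : algebraMap R X.functionField d * φ (w l) = 0 := by
      have h10 := congrArg (algebraMap R X.functionField) h6
      rw [map_zero, map_sum] at h10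
      rw [← h10, map_sum, Finset.mul_sum]
      refine Finset.sum_congr rfl fun i _ => ?_
      rw [map_mul, map_smul, hr i, smul_eq_mul]
      have h11 : (d : R) • φ (m i) = algebraMap R X.functionField d * φ (m i) :=
        Algebra.smul_def _ _
      have h12 : d • φ (m i) = (d : R) • φ (m i) := rfl
      first | rw [h12, h11] | rw [h11]
      ring
    exact (mul_eq_zero.1 h9).resolve_left hd0
  have hvw : v = ∑ l, algebraMap S Y.functionField (z (Finsupp.single l 1)) •
      pullbackVectorField π (w l) := by
    rw [hv']
    simp only [w, pullbackVectorField_sum, pullbackVectorField_smul, Finset.smul_sum, smul_smul]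
    rw [Finset.sum_comm]
    refine Finset.sum_congr rfl fun i _ => ?_
    rw [← Finset.sum_smul, hgc i, map_sum]
    congr 1
    refine Finset.sum_congr rfl fun l _ => ?_
    rw [map_mul, mul_comm]
    congr 1
    exact (pullbackFunctions_algebraMap π y _).symm
  rw [hvw]
  exact Submodule.sum_mem _ fun l _ =>
    Submodule.smul_mem _ (⟨_, _, rfl⟩ : localRing Y y)
      (Submodule.subset_span ⟨w l, ⟨hwT l, hwW l⟩, rfl⟩)

end Descent

/-! ### Canonical divisors in terms of local bases -/

section Canonical

variable {X : Scheme.{0}} [IsIntegral X] {V : Type} [AddCommGroup V] [Module X.functionField V]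

/-- The basis `b` of the subspace `W` is an `𝒪_{X,x}`-basis of the stalk of `E` at `x`: an element
of `W` lies in the stalk if and only if its coordinates are regular at `x`. -/
def IsStalkBasis (E : StalkFamily X V) (x : X) {W : Submodule X.functionField V} {n : ℕ}
    (b : Module.Basis (Fin n) X.functionField W) : Prop :=
  ∀ v : W, (v : V) ∈ E x ↔ ∀ i, b.coord i v ∈ localRing X x

variable {n : ℕ}

lemma IsStalkBasis.apply_mem {E : StalkFamily X V} {x : X} {W : Submodule X.functionField V}
    {b : Module.Basis (Fin n) X.functionField W} (hb : IsStalkBasis E x b) (i : Fin n) :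
    (b i : V) ∈ E x := by
  refine (hb _).2 fun j => ?_
  rw [Module.Basis.coord_apply, Module.Basis.repr_self, Finsupp.single_apply]
  split_ifs
  · exact one_mem _
  · exact zero_mem _

lemma det_mem_of_repr_mem {R : Subring X.functionField} (β : Module.Basis (Fin n) X.functionField V)
    {v : Fin n → V} (h : ∀ i j, β.repr (v i) j ∈ R) : β.det v ∈ R := by
  rw [Module.Basis.det_apply, Matrix.det_apply]
  refine sum_mem fun σ _ => ?_
  rw [Units.smul_def, zsmul_eq_mul]
  exact mul_mem (intCast_mem R _) (prod_mem fun i _ => h _ _)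

/-- A basis of a free stalk of full rank gives a generator of the top exterior power. -/
lemma topExteriorPower_eq_span (E : StalkFamily X V) (x : X)
    (β : Module.Basis (Fin (sheafRank E)) X.functionField V)
    (hβ : ∀ v, v ∈ E x ↔ ∀ i, β.repr v i ∈ localRing X x) :
    topExteriorPower E x =
      Submodule.span (localRing X x) {exteriorPower.ιMulti X.functionField (sheafRank E) β} := by
  refine le_antisymm (Submodule.span_le.2 ?_) (Submodule.span_mono ?_)
  · rintro _ ⟨v, hv, rfl⟩
    rw [ιMulti_eq_det_smul β v]
    exact Submodule.smul_mem _ (⟨_, det_mem_of_repr_mem β fun i => (hβ _).1 (hv i)⟩ : localRing X x)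
      (Submodule.mem_span_singleton_self _)
  · rintro _ rfl
    refine ⟨β, fun i => (hβ _).2 fun j => ?_, rfl⟩
    rw [Module.Basis.repr_self, Finsupp.single_apply]
    split_ifs
    · exact one_mem _
    · exact zero_mem _

/-- The dual basis of a stalk basis is a basis of the stalk of the dual sheaf. -/
lemma mem_dualSheaf_iff {E : StalkFamily X V} {x : X}
    {b : Module.Basis (Fin n) X.functionField (genericStalk E)} (hb : IsStalkBasis E x b)
    (φ : Module.Dual X.functionField (genericStalk E)) :
    φ ∈ dualSheaf E x ↔ ∀ i, b.dualBasis.repr φ i ∈ localRing X x := by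
  simp only [Module.Basis.dualBasis_repr]
  constructor
  · intro h i
    exact h (b i : V) (hb.apply_mem i)
  · intro h v hv
    have h1 := (hb ⟨v, mem_genericStalk E hv⟩).1 hv
    rw [← b.sum_repr ⟨v, mem_genericStalk E hv⟩, map_sum]
    refine sum_mem fun i _ => ?_
    rw [map_smul]
    exact mul_mem (h1 i) (h i)

lemma genericStalk_dualSheaf (E : StalkFamily X V) : genericStalk (dualSheaf E) = ⊤ := by
  refine eq_top_iff.2 fun φ _ => mem_genericStalk (x := genericPoint X) _ fun v hv => ?_
  rw [localRing_genericPoint]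
  trivial

lemma sheafRank_dualSheaf (E : StalkFamily X V)
    (b : Module.Basis (Fin n) X.functionField (genericStalk E)) : sheafRank (dualSheaf E) = n := by
  rw [sheafRank, genericStalk_dualSheaf, finrank_top, Module.finrank_eq_card_basis b.dualBasis,
    Fintype.card_fin]

variable [IsLocallyNoetherian X]

lemma ord_eq_zero_of_isUnit {x : X} (hx : Order.coheight x = 1) {u u' : X.functionField}
    (hu : u ∈ localRing X x) (hu' : u' ∈ localRing X x) (h : u * u' = 1) :
    Scheme.ord u x = 0 := by
  have h0 : u ≠ 0 := left_ne_zero_of_mul_eq_one h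
  have h0' : u' ≠ 0 := right_ne_zero_of_mul_eq_one h
  have h1 := Scheme.ord_mul (x := x) h0 h0'
  rw [h, ord_one_eq hx] at h1
  obtain ⟨g, rfl⟩ := hu
  obtain ⟨g', rfl⟩ := hu'
  have := ord_algebraMap_nonneg hx g
  have := ord_algebraMap_nonneg hx g'
  omega

/-- A canonical divisor of `E` is the divisor of a rational section of `det E^*`; in local bases of
`E` it is the order of a fixed rational function times the determinant of the local basis. -/
lemma IsCanonicalDivisor.exists_ord_eq {E : StalkFamily X V} {W : Submodule X.functionField V}
    (hW : genericStalk E = W) (b₀ : Module.Basis (Fin n) X.functionField W)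
    {D : PrimeDivisor X → ℤ} (hD : IsCanonicalDivisor E D) :
    ∃ c : X.functionField, c ≠ 0 ∧ ∀ (P : PrimeDivisor X)
      (b : Module.Basis (Fin n) X.functionField W), IsStalkBasis E P.point b →
        D P = Scheme.ord (c * b₀.det b) P.point := by
  subst hW
  obtain rfl := sheafRank_dualSheaf E b₀
  obtain ⟨s, hs0, hs⟩ := hD
  obtain ⟨c, rfl⟩ := exists_eq_smul_ιMulti b₀.dualBasis s
  refine ⟨c, fun h => hs0 (by rw [h, zero_smul]), fun P b hb => ?_⟩
  obtain ⟨t, g, ht, hst, hDP⟩ := hs P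
  rw [topExteriorPower_eq_span _ _ b.dualBasis (mem_dualSheaf_iff hb)] at ht
  set τ := exteriorPower.ιMulti X.functionField _ b.dualBasis with hτ
  have hτ0 : τ ≠ 0 := ιMulti_basis_ne_zero _
  obtain ⟨u, hu⟩ := Submodule.mem_span_singleton.1
    (ht.symm ▸ Submodule.mem_span_singleton_self t : t ∈ Submodule.span (localRing X P.point) {τ})
  obtain ⟨u', hu'⟩ := Submodule.mem_span_singleton.1
    (ht ▸ Submodule.mem_span_singleton_self τ : τ ∈ Submodule.span (localRing X P.point) {t})
  rw [Subring.smul_def] at hu hu'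
  have huu : (u : X.functionField) * u' = 1 := by
    refine smul_left_injective X.functionField hτ0 ?_
    change ((u : X.functionField) * u') • τ = (1 : X.functionField) • τ
    rw [mul_comm, mul_smul, hu, hu', one_smul]
  have hgc : g * u = c * b₀.det b := by
    refine smul_left_injective X.functionField hτ0 ?_
    change (g * u) • τ = (c * b₀.det b) • τ
    rw [mul_smul, hu, ← hst, ιMulti_eq_det_smul b.dualBasis b₀.dualBasis,
      dualBasis_det_dualBasis, smul_smul]
  have hc0 : c * b₀.det b ≠ 0 :=
    mul_ne_zero (fun h => hs0 (by rw [h, zero_smul])) (b₀.isUnit_det b).ne_zero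
  have hg0 : g ≠ 0 := by
    rintro rfl
    rw [zero_mul] at hgc
    exact hc0 hgc.symm
  rw [hDP, ← hgc, Scheme.ord_mul hg0 (left_ne_zero_of_mul_eq_one huu),
    ord_eq_zero_of_isUnit P.codim_one u.2 u'.2 huu, add_zero]

/-- The converse of `IsCanonicalDivisor.exists_ord_eq`. -/
lemma isCanonicalDivisor_of_ord_eq {E : StalkFamily X V} {W : Submodule X.functionField V}
    (hW : genericStalk E = W) (b₀ : Module.Basis (Fin n) X.functionField W)
    {D : PrimeDivisor X → ℤ} {c : X.functionField} (hc : c ≠ 0)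
    (hD : ∀ P : PrimeDivisor X, ∃ b : Module.Basis (Fin n) X.functionField W,
      IsStalkBasis E P.point b ∧ D P = Scheme.ord (c * b₀.det b) P.point) :
    IsCanonicalDivisor E D := by
  subst hW
  obtain rfl := sheafRank_dualSheaf E b₀
  refine ⟨c • exteriorPower.ιMulti X.functionField _ b₀.dualBasis,
    smul_ne_zero hc (ιMulti_basis_ne_zero _), fun P => ?_⟩
  obtain ⟨b, hb, hDP⟩ := hD P
  refine ⟨exteriorPower.ιMulti X.functionField _ b.dualBasis, c * b₀.det b,
    topExteriorPower_eq_span _ _ b.dualBasis (mem_dualSheaf_iff hb), ?_, hDP⟩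
  rw [ιMulti_eq_det_smul b.dualBasis b₀.dualBasis, dualBasis_det_dualBasis, smul_smul]

end Canonical

/-! ### Vector fields near the generic point of a prime divisor -/

section Invariance

variable {X : Scheme.{0}}

/-- Specialization between points of codimension one is trivial. -/
lemma PrimeDivisor.eq_of_specializes {P Q : PrimeDivisor X} (h : P.point ⤳ Q.point) : P = Q := by
  have h1 : P.point = Q.point := by
    by_contra hne
    have hlt : Q.point < P.point :=
      lt_of_le_not_ge h fun h' => hne (h.antisymm h').eq
    have h2 := Order.coheight_strictAnti hlt (by rw [P.codim_one]; exact ENat.one_lt_top)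
    rw [P.codim_one, Q.codim_one] at h2
    exact lt_irrefl _ h2
  cases P; cases Q; cases h1; rfl

lemma PrimeDivisor.ideal_point (P : PrimeDivisor X) (h : P.point ⤳ P.point) :
    P.ideal P.point h = IsLocalRing.maximalIdeal (X.presheaf.stalk P.point) := by
  rw [PrimeDivisor.ideal, TopCat.Presheaf.stalkSpecializes_refl]
  exact Ideal.comap_id _

variable [IsIntegral X] [X.Over SpecC]

lemma vectorFieldsIn_mono_of_specializes [LocallyOfFiniteType (X ↘ SpecC)]
    (W : Submodule X.functionField (RationalVectorField X)) {x y : X} (h : y ⤳ x)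
    {v : RationalVectorField X} (hv : v ∈ vectorFieldsIn W x) : v ∈ vectorFieldsIn W y := by
  obtain ⟨U, A, hx, -, hA⟩ := exists_chart x
  have hle := localRing_mono h
  have hy : y ∈ U := h.mem_open U.isOpen hx
  exact ⟨derivation_mem_of_localization (A := A) v (hA y hy).1
    (fun a ha => hle (hv.1 a ((hA x hx).1 a ha))) (hA y hy).2, hv.2⟩

variable {W : Submodule X.functionField (RationalVectorField X)} {P : PrimeDivisor X}
  [IsDiscreteValuationRing (X.presheaf.stalk P.point)] {ϖ : X.presheaf.stalk P.point}

/-- A vector field tangent to the divisor multiplies the local equation by a regular function. -/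
lemma mul_inv_mem_of_isInvariant (hϖ : Irreducible ϖ) (h : IsInvariant (vectorFieldsIn W) P)
    {v : RationalVectorField X} (hv : v ∈ vectorFieldsIn W P.point) :
    v (algebraMap _ X.functionField ϖ) * (algebraMap _ X.functionField ϖ)⁻¹ ∈
      localRing X P.point := by
  have hm : ϖ ∈ P.ideal P.point specializes_rfl := by
    rw [P.ideal_point, hϖ.maximalIdeal_eq]
    exact Ideal.mem_span_singleton_self ϖ
  obtain ⟨g, hg, hvg⟩ := h P.point specializes_rfl v hv ϖ hm
  rw [P.ideal_point, hϖ.maximalIdeal_eq] at hg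
  obtain ⟨r, rfl⟩ := Ideal.mem_span_singleton.1 hg
  have h0 : algebraMap _ X.functionField ϖ ≠ 0 := by
    rw [Ne, map_eq_zero_iff _ (algebraMap_stalk_injective _)]
    exact hϖ.ne_zero
  refine ⟨r, ?_⟩
  rw [hvg, map_mul]
  field_simp

/-- If the divisor is not invariant, some vector field is transverse to it at its generic point. -/
lemma exists_unit_of_not_isInvariant [LocallyOfFiniteType (X ↘ SpecC)] (hϖ : Irreducible ϖ)
    (h : ¬ IsInvariant (vectorFieldsIn W) P) :
    ∃ v ∈ vectorFieldsIn W P.point, ∃ g : X.presheaf.stalk P.point, IsUnit g ∧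
      algebraMap _ X.functionField g = v (algebraMap _ X.functionField ϖ) := by
  by_contra hcon
  push Not at hcon
  refine h fun x hx v hv f hf => ?_
  have hvP := vectorFieldsIn_mono_of_specializes W hx hv
  obtain ⟨g, hg⟩ := hv.1 _ ⟨f, rfl⟩
  refine ⟨g, ?_, hg.symm⟩
  obtain ⟨r, hr⟩ := hvP.1 _ ⟨ϖ, rfl⟩
  have hrm : r ∈ IsLocalRing.maximalIdeal (X.presheaf.stalk P.point) := by
    rw [IsLocalRing.mem_maximalIdeal]
    exact fun hu => hcon v hvP r hu hr
  have hf' : (X.presheaf.stalkSpecializes hx).hom f ∈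
    IsLocalRing.maximalIdeal (X.presheaf.stalk P.point) := hf
  have hf2 := hf'
  rw [hϖ.maximalIdeal_eq] at hf2
  obtain ⟨q, hq⟩ := Ideal.mem_span_singleton.1 hf2
  obtain ⟨q', hq'⟩ := hvP.1 _ ⟨q, rfl⟩
  have hgeq : (X.presheaf.stalkSpecializes hx).hom g = ϖ * q' + q * r := by
    refine algebraMap_stalk_injective P.point ?_
    rw [algebraMap_stalkSpecializes, hg, ← algebraMap_stalkSpecializes hx f, hq, map_mul,
      Derivation.leibniz, map_add, map_mul, map_mul, hq', hr]
    rfl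
  change (X.presheaf.stalkSpecializes hx).hom g ∈
    IsLocalRing.maximalIdeal (X.presheaf.stalk P.point)
  rw [hgeq]
  refine add_mem (Ideal.mul_mem_right _ _ ?_) (Ideal.mul_mem_left _ _ hrm)
  rw [hϖ.maximalIdeal_eq]
  exact Ideal.mem_span_singleton_self ϖ

end Invariance

section LocalBasis

variable {X : Scheme.{0}} [IsIntegral X] [X.Over SpecC]

/-- The functional `v ↦ v f` on a space of vector fields. -/
def evalFunctional (W : Submodule X.functionField (RationalVectorField X)) (f : X.functionField) :
    Module.Dual X.functionField W where
  toFun v := (v : RationalVectorField X) f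
  map_add' _ _ := rfl
  map_smul' _ _ := rfl

lemma evalFunctional_apply (W : Submodule X.functionField (RationalVectorField X))
    (f : X.functionField) (v : W) : evalFunctional W f v = (v : RationalVectorField X) f := rfl

/-- The functionals given by the differentials of the functions that are regular at `x`. -/
def regularFunctionals (W : Submodule X.functionField (RationalVectorField X)) (x : X) :
    Set (Module.Dual X.functionField W) :=
  evalFunctional W '' (localRing X x : Set X.functionField)

variable [LocallyOfFiniteType (X ↘ SpecC)]

/-- At a point whose local ring is a discrete valuation ring, the vector fields in `W` have a basis
whose coordinates are combinations of the functionals `v ↦ v f` with `f` regular. -/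
lemma exists_stalkBasis (W : Submodule X.functionField (RationalVectorField X)) (x : X)
    [IsDiscreteValuationRing (X.presheaf.stalk x)] :
    ∃ b : Module.Basis (Fin (Module.finrank X.functionField W)) X.functionField W,
      (∀ i, b.coord i ∈ Submodule.span (localRing X x) (regularFunctionals W x)) ∧
      IsStalkBasis (vectorFieldsIn W) x b := by
  have hpir : IsPrincipalIdealRing (localRing X x) :=
    IsPrincipalIdealRing.of_surjective (stalkEquiv x).toRingHom (stalkEquiv x).surjective
  have hsep : ∀ w : W, (∀ φ ∈ regularFunctionals W x, φ w = 0) → w = 0 := by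
    intro w hw
    refine Subtype.ext (Derivation.ext fun f => ?_)
    obtain ⟨p, q, -, rfl⟩ := IsFractionRing.div_surjective (A := localRing X x) f
    have h1 : (w : RationalVectorField X) p = 0 := Set.forall_mem_image.1 hw p.2
    have h2 : (w : RationalVectorField X) q = 0 := Set.forall_mem_image.1 hw q.2
    change (w : RationalVectorField X) ((p : X.functionField) / q) = 0
    rw [div_eq_mul_inv, Derivation.leibniz, Derivation.leibniz_inv, h1, h2]
    simp
  have hbd : ∀ w : W, ∃ r ∈ localRing X x, r ≠ 0 ∧
      ∀ φ ∈ regularFunctionals W x, r * φ w ∈ localRing X x := by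
    intro w
    obtain ⟨g, hg, hgw⟩ := exists_smul_mem_stalk (vectorFieldsIn_coherent W) x
      (v := (w : RationalVectorField X)) (by rw [genericStalk_vectorFieldsIn]; exact w.2)
    refine ⟨g, g.2, by simpa using hg, ?_⟩
    exact Set.forall_mem_image.2 fun f hf => hgw.1 f hf
  obtain ⟨b, hb1, hb2⟩ :=
    exists_basis_of_functionals (localRing X x) (regularFunctionals W x) hsep hbd
  refine ⟨b, hb1, fun v => ?_⟩
  rw [← hb2, mem_vectorFieldsIn]
  exact ⟨fun h => Set.forall_mem_image.2 fun f hf => h.1 f hf,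
    fun h => ⟨fun f hf => Set.forall_mem_image.1 h hf, v.2⟩⟩

/-- At the generic point of a divisor that is not invariant, the functional given by the
differential of the local equation is one of the coordinates of a suitable basis. -/
lemma exists_stalkBasis_of_not_isInvariant
    {W : Submodule X.functionField (RationalVectorField X)} {P : PrimeDivisor X}
    [IsDiscreteValuationRing (X.presheaf.stalk P.point)] {ϖ : X.presheaf.stalk P.point}
    (hϖ : Irreducible ϖ) (h : ¬ IsInvariant (vectorFieldsIn W) P) :
    ∃ (b : Module.Basis (Fin (Module.finrank X.functionField W)) X.functionField W)
      (i₀ : Fin (Module.finrank X.functionField W)),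
      (∀ i, b.coord i ∈
        Submodule.span (localRing X P.point) (regularFunctionals W P.point)) ∧
      b.coord i₀ = evalFunctional W (algebraMap _ X.functionField ϖ) ∧
      IsStalkBasis (vectorFieldsIn W) P.point b := by
  obtain ⟨b, hb1, hb2⟩ := exists_stalkBasis W P.point
  obtain ⟨v, hv, g, hg, hgv⟩ := exists_unit_of_not_isInvariant hϖ h
  set ℓ := evalFunctional W (algebraMap _ X.functionField ϖ) with hℓ
  have hreg : ∀ i, ℓ (b i) ∈ localRing X P.point := fun i => (hb2.apply_mem i).1 _ ⟨ϖ, rfl⟩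
  choose r hr using hreg
  choose c hc using (hb2 ⟨v, hv.2⟩).1 hv
  have hsum : g = ∑ i, c i * r i := by
    refine algebraMap_stalk_injective P.point ?_
    rw [hgv, map_sum]
    have h1 : v (algebraMap _ X.functionField ϖ) = ℓ ⟨v, hv.2⟩ := rfl
    rw [h1]
    conv_lhs => rw [← b.sum_repr ⟨v, hv.2⟩, map_sum]
    refine Finset.sum_congr rfl fun i _ => ?_
    rw [map_smul, map_mul, hc, hr]
    rfl
  obtain ⟨i₀, hi₀⟩ : ∃ i, IsUnit (r i) := by
    by_contra hcon
    push Not at hcon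
    have : g ∈ IsLocalRing.maximalIdeal (X.presheaf.stalk P.point) := by
      rw [hsum]
      exact Ideal.sum_mem _ fun i _ =>
        Ideal.mul_mem_left _ _ ((IsLocalRing.mem_maximalIdeal _).2 (hcon i))
    exact (IsLocalRing.mem_maximalIdeal _).1 this hg
  obtain ⟨b', hb'1, hb'2, hb'3⟩ := exists_basis_replace_coord (localRing X P.point) b ℓ
    (fun i => ⟨r i, hr i⟩) i₀
    (by rw [← hr, Ne, map_eq_zero_iff _ (algebraMap_stalk_injective _)]; exact hi₀.ne_zero)
    (by rw [← hr]; exact (isUnit_stalk_iff hi₀.ne_zero).1 hi₀)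
  refine ⟨b', i₀, fun i => ?_, hb'2, fun w => ?_⟩
  · rcases eq_or_ne i i₀ with rfl | hi
    · rw [hb'2]
      exact Submodule.subset_span ⟨_, ⟨ϖ, rfl⟩, rfl⟩
    · rw [hb'1 i hi]
      exact hb1 i
  · rw [hb2, hb'3]

end LocalBasis

/-! ### Pulled back bases and the orbifold tangent sheaf in codimension one -/

section PullbackBasis

variable {X Y : Scheme.{0}} [IsIntegral X] [IsIntegral Y] [X.Over SpecC]
  (π : Y ⟶ X) [IsDominant π] [Module.Finite X.functionField (FunctionFieldOver π)]
  [IsGalois X.functionField (FunctionFieldOver π)]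
  {W : Submodule Y.functionField (PullbackVectorField π)} {n : ℕ}

lemma span_range_pullbackVectorField (hW : IsStableSubspace π W)
    (b : Module.Basis (Fin n) X.functionField (descendedFields π W)) :
    Submodule.span Y.functionField (Set.range fun i => pullbackVectorField π (b i)) = W := by
  refine le_antisymm (Submodule.span_le.2 ?_) ?_
  · rintro _ ⟨i, rfl⟩
    exact (b i).2
  · conv_lhs => rw [← span_descendedFields π hW]
    refine Submodule.span_le.2 ?_
    rintro _ ⟨w, hw, rfl⟩
    have h1 : w = ∑ i, b.repr ⟨w, hw⟩ i • (b i : RationalVectorField X) := by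
      have := congrArg (descendedFields π W).subtype (b.sum_repr ⟨w, hw⟩)
      rw [map_sum] at this
      exact this.symm
    rw [h1, pullbackVectorField_sum]
    refine Submodule.sum_mem _ fun i _ => ?_
    rw [pullbackVectorField_smul]
    exact Submodule.smul_mem _ _ (Submodule.subset_span ⟨i, rfl⟩)

/-- The basis of a stable subspace obtained by pulling back a basis of the descended subspace. -/
def pullbackBasis (hW : IsStableSubspace π W)
    (b : Module.Basis (Fin n) X.functionField (descendedFields π W)) :
    Module.Basis (Fin n) Y.functionField W :=
  (Module.Basis.span (v := fun i => pullbackVectorField π (b i))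
    (linearIndependent_pullbackVectorField π
      (b.linearIndependent.map' (descendedFields π W).subtype (Submodule.ker_subtype _)))).map
    (LinearEquiv.ofEq _ _ (span_range_pullbackVectorField π hW b))

variable (hW : IsStableSubspace π W)
  (b b₀ : Module.Basis (Fin n) X.functionField (descendedFields π W))

lemma pullbackBasis_apply (i : Fin n) :
    (pullbackBasis π hW b i : PullbackVectorField π) = pullbackVectorField π (b i) := by
  rw [pullbackBasis, Module.Basis.map_apply, LinearEquiv.coe_ofEq_apply, Module.Basis.span_apply]

lemma pullbackBasis_repr (w : descendedFields π W) (i : Fin n) :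
    (pullbackBasis π hW b).repr ⟨pullbackVectorField π w, w.2⟩ i =
      pullbackFunctions π (b.repr w i) := by
  have h : (⟨pullbackVectorField π w, w.2⟩ : W) =
      ∑ j, pullbackFunctions π (b.repr w j) • pullbackBasis π hW b j := by
    refine Subtype.ext ?_
    refine Eq.trans ?_ (map_sum W.subtype _ _).symm
    have h1 : (w : RationalVectorField X) = ∑ i, b.repr w i • (b i : RationalVectorField X) := by
      have := congrArg (descendedFields π W).subtype (b.sum_repr w)
      rw [map_sum] at this
      exact this.symm
    refine ((congrArg (pullbackVectorField π) h1).trans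
      (pullbackVectorField_sum π _ _)).trans ?_
    refine Finset.sum_congr rfl fun j _ => ?_
    rw [pullbackVectorField_smul, map_smul, Submodule.subtype_apply, pullbackBasis_apply]
  rw [h, Module.Basis.repr_sum_self]

lemma pullbackBasis_det :
    (pullbackBasis π hW b₀).det (pullbackBasis π hW b) = pullbackFunctions π (b₀.det b) := by
  rw [Module.Basis.det_apply, Module.Basis.det_apply, RingHom.map_det]
  congr 1
  ext i j
  rw [Module.Basis.toMatrix_apply, RingHom.mapMatrix_apply, Matrix.map_apply,
    Module.Basis.toMatrix_apply, ← pullbackBasis_repr π hW]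
  congr 2
  exact Subtype.ext (pullbackBasis_apply π hW b j)

lemma apply_eq_sum_coord (v : W) (f : X.functionField) :
    toFunctionField π ((v : PullbackVectorField π) f) =
      ∑ i, (pullbackBasis π hW b).coord i v *
        pullbackFunctions π ((b i : RationalVectorField X) f) := by
  have h1 : (v : PullbackVectorField π) =
      ∑ i, (pullbackBasis π hW b).coord i v • pullbackVectorField π (b i) := by
    have := congrArg W.subtype ((pullbackBasis π hW b).sum_repr v)
    rw [map_sum] at this
    refine this.symm.trans ?_
    refine Finset.sum_congr rfl fun j _ => ?_
    rw [map_smul, Submodule.subtype_apply, pullbackBasis_apply]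
    rfl
  conv_lhs => rw [h1]
  rw [← Derivation.coeFnAddMonoidHom_apply (∑ i, _), map_sum, Finset.sum_apply, map_sum]
  rfl

/-- The sum is the value at `v` of the `ℂ(Y)`-linear extension of `φ`. -/
lemma sum_coord_mul_mem {y : Y} {v : W}
    (hv : ∀ f ∈ localRing X (π y),
      toFunctionField π ((v : PullbackVectorField π) f) ∈ localRing Y y)
    {φ : Module.Dual X.functionField (descendedFields π W)}
    (hφ : φ ∈ Submodule.span (localRing X (π y))
      (regularFunctionals (descendedFields π W) (π y))) :
    ∑ i, (pullbackBasis π hW b).coord i v * pullbackFunctions π (φ (b i)) ∈ localRing Y y := by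
  induction hφ using Submodule.span_induction with
  | mem φ h =>
    obtain ⟨f, hf, rfl⟩ := h
    simp only [evalFunctional_apply]
    rw [← apply_eq_sum_coord]
    exact hv f hf
  | zero => simp
  | add φ ψ _ _ h h' =>
    simp only [LinearMap.add_apply, map_add, mul_add, Finset.sum_add_distrib]
    exact add_mem h h'
  | smul c φ _ h =>
    have h1 : ∀ i, (pullbackBasis π hW b).coord i v * pullbackFunctions π ((c • φ) (b i)) =
        pullbackFunctions π (c : X.functionField) *
          ((pullbackBasis π hW b).coord i v * pullbackFunctions π (φ (b i))) := by
      intro i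
      have h2 : (c • φ) (b i) = (c : X.functionField) * φ (b i) := rfl
      rw [h2, map_mul]
      ring
    simp only [h1, ← Finset.mul_sum]
    exact mul_mem (pullbackFunctions_mem π y c.2) h

/-- With `apply_eq_sum_coord`, this says that the regular elements of `W` are the combinations of
the pulled back basis with regular coefficients. -/
lemma coord_mem_of_mem_span {y : Y} {v : W}
    (hv : ∀ f ∈ localRing X (π y),
      toFunctionField π ((v : PullbackVectorField π) f) ∈ localRing Y y) {i : Fin n}
    (hi : b.coord i ∈ Submodule.span (localRing X (π y))
      (regularFunctionals (descendedFields π W) (π y))) :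
    (pullbackBasis π hW b).coord i v ∈ localRing Y y := by
  have h := sum_coord_mul_mem π hW b hv hi
  rwa [Finset.sum_eq_single i, Module.Basis.coord_apply b, Module.Basis.repr_self,
    Finsupp.single_eq_same, map_one, mul_one] at h
  · intro j _ hj
    rw [Module.Basis.coord_apply b, Module.Basis.repr_self, Finsupp.single_apply, if_neg hj,
      map_zero, mul_zero]
  · exact fun h => absurd (Finset.mem_univ i) h

lemma coord_eq_apply {v : W} {i : Fin n} {f : X.functionField}
    (hi : b.coord i = evalFunctional (descendedFields π W) f) :
    (pullbackBasis π hW b).coord i v = toFunctionField π ((v : PullbackVectorField π) f) := by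
  rw [apply_eq_sum_coord π hW b, Finset.sum_eq_single i]
  · rw [← evalFunctional_apply, ← hi, Module.Basis.coord_apply b, Module.Basis.repr_self,
      Finsupp.single_eq_same, map_one, mul_one]
  · intro j _ hj
    rw [← evalFunctional_apply, ← hi, Module.Basis.coord_apply b, Module.Basis.repr_self,
      Finsupp.single_apply, if_neg hj, map_zero, mul_zero]
  · exact fun h => absurd (Finset.mem_univ i) h

end PullbackBasis

section Multiplicities

variable {X Y : Scheme.{0}}

lemma orbA_pos (Δ : PrimeDivisor X →₀ ℚ) (P : PrimeDivisor X) : 0 < orbA Δ P :=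
  (1 - Δ P).den_pos

lemma orbA_mul (Δ : PrimeDivisor X →₀ ℚ) (P : PrimeDivisor X) :
    (orbA Δ P : ℚ) * Δ P = orbA Δ P - orbB Δ P := by
  have h : (1 - Δ P) * (orbA Δ P : ℚ) = orbB Δ P := Rat.mul_den_eq_num _
  linarith

lemma orbB_nonneg {Δ : PrimeDivisor X →₀ ℚ} {P : PrimeDivisor X} (h : Δ P ≤ 1) :
    0 ≤ orbB Δ P :=
  Rat.num_nonneg.2 (by linarith)

lemma orbB_le_orbA {Δ : PrimeDivisor X →₀ ℚ} {P : PrimeDivisor X} (h : 0 ≤ Δ P) :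
    orbB Δ P ≤ orbA Δ P := by
  have h1 := orbA_mul Δ P
  have h2 : (0 : ℚ) ≤ orbA Δ P * Δ P := mul_nonneg (Nat.cast_nonneg _) h
  have h3 : (orbB Δ P : ℚ) ≤ orbA Δ P := by linarith
  exact_mod_cast h3

/-- The multiplicity of `b D` along a component `Q` of `D = (1/a) π^* P` is `b`. -/
lemma orbifoldDivisor_apply (π : Y ⟶ X) (Δ : PrimeDivisor X →₀ ℚ) (Q : PrimeDivisor Y)
    (hP : Order.coheight (π Q.point) = 1)
    (hram : ramificationIndex π Q = orbA Δ ⟨π Q.point, hP⟩) :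
    (-((orbB Δ ⟨π Q.point, hP⟩ : ℚ) • (1 / (orbA Δ ⟨π Q.point, hP⟩ : ℚ)) •
      pullbackDivisor π (Finsupp.single (⟨π Q.point, hP⟩ : PrimeDivisor X) 1))) Q =
      -(orbB Δ ⟨π Q.point, hP⟩ : ℚ) := by
  have h0 : (orbA Δ ⟨π Q.point, hP⟩ : ℚ) ≠ 0 := by
    exact_mod_cast (orbA_pos Δ _).ne'
  simp only [Pi.neg_apply, Pi.smul_apply, smul_eq_mul, pullbackDivisor, dif_pos hP,
    Finsupp.single_eq_same, hram]
  field_simp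

end Multiplicities

section OrbifoldTangent

variable {X Y : Scheme.{0}} [IsIntegral X] [IsIntegral Y] [X.Over SpecC]
  (π : Y ⟶ X) [IsDominant π]

lemma pairing_tmul (v : PullbackVectorField π) (g : FunctionFieldOver π)
    (η : Ω[X.functionField⁄ℂ]) :
    pairing π v (g ⊗ₜ η) =
      toFunctionField π g * toFunctionField π (v.liftKaehlerDifferential η) := by
  rw [pairing, LinearMap.liftBaseChange_tmul]
  rfl

lemma pairing_add_right (v : PullbackVectorField π) (ω ω' : PullbackForm π) :
    pairing π v (ω + ω') = pairing π v ω + pairing π v ω' := by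
  rw [pairing, map_add, map_add]
  rfl

lemma pairing_zero_right (v : PullbackVectorField π) : pairing π v 0 = 0 := by
  rw [pairing, map_zero, map_zero]

lemma pairing_smul_right (v : PullbackVectorField π) (c : Y.functionField) (ω : PullbackForm π) :
    pairing π v (c • ω) = c * pairing π v ω := by
  induction ω using TensorProduct.induction_on with
  | zero => rw [smul_zero, pairing_zero_right, mul_zero]
  | tmul g η =>
    rw [TensorProduct.smul_tmul', pairing_tmul, pairing_tmul, ← mul_assoc]
    rfl
  | add a b ha hb => rw [smul_add, pairing_add_right, ha, hb, pairing_add_right, mul_add]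

lemma pairing_D (v : PullbackVectorField π) (f : X.functionField) :
    pairing π v (1 ⊗ₜ KaehlerDifferential.D ℂ X.functionField f) = toFunctionField π (v f) := by
  rw [pairing_tmul, map_one, one_mul, Derivation.liftKaehlerDifferential_comp_D]

lemma pairing_dlog (v : PullbackVectorField π) (g : FunctionFieldOver π) (z : X.functionField) :
    pairing π v (g ⊗ₜ dlog z) =
      toFunctionField π g * ((pullbackFunctions π z)⁻¹ * toFunctionField π (v z)) := by
  rw [pairing_tmul, dlog, map_smul, Derivation.liftKaehlerDifferential_comp_D, Algebra.smul_def,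
    map_mul, map_inv₀, map_inv₀]
  rfl

variable [IsLocallyNoetherian X] [IsLocallyNoetherian Y]

variable {Q : PrimeDivisor Y} [IsDiscreteValuationRing (X.presheaf.stalk (π Q.point))]
  [IsDiscreteValuationRing (Y.presheaf.stalk Q.point)]

lemma mul_mem_of_ord {f g : Y.functionField} (hf : f ∈ localRing Y Q.point) (hg : g ≠ 0)
    (h : 0 ≤ Scheme.ord g Q.point) : g * f ∈ localRing Y Q.point :=
  mul_mem ((mem_localRing_iff_ord Q.codim_one hg).2 h) hf

lemma algebraMap_ne_zero_of_irreducible {Z : Scheme.{0}} [IsIntegral Z] {z : Z}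
    {ϖ : Z.presheaf.stalk z} (hϖ : Irreducible ϖ) :
    algebraMap (Z.presheaf.stalk z) Z.functionField ϖ ≠ 0 := by
  rw [Ne, map_eq_zero_iff _ (algebraMap_stalk_injective _)]
  exact hϖ.ne_zero

/-- In codimension one, the vector fields in `T(π, Δ)` are the regular ones whose value at the
local equation of a component of `Δ` vanishes to order at least `a - b`. -/
lemma mem_orbifoldTangent_iff {Δ : PrimeDivisor X →₀ ℚ} (hP : Order.coheight (π Q.point) = 1)
    (hram : (⟨π Q.point, hP⟩ : PrimeDivisor X) ∈ Δ.support →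
      ramificationIndex π Q = orbA Δ ⟨π Q.point, hP⟩)
    {τ : Y.presheaf.stalk Q.point} (hτ : Irreducible τ) (v : PullbackVectorField π) :
    v ∈ orbifoldTangent π Δ Q.point ↔
      (∀ f ∈ localRing X (π Q.point), toFunctionField π (v f) ∈ localRing Y Q.point) ∧
      ((⟨π Q.point, hP⟩ : PrimeDivisor X) ∈ Δ.support →
        ∀ ϖ : X.presheaf.stalk (π Q.point), Irreducible ϖ →
        (algebraMap _ Y.functionField τ) ^
            (orbB Δ ⟨π Q.point, hP⟩ - (orbA Δ ⟨π Q.point, hP⟩ : ℤ)) *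
          toFunctionField π (v (algebraMap _ X.functionField ϖ)) ∈ localRing Y Q.point) := by
  set t := algebraMap _ Y.functionField τ with ht
  set P : PrimeDivisor X := ⟨π Q.point, hP⟩ with hPdef
  have ht0 : t ≠ 0 := algebraMap_ne_zero_of_irreducible hτ
  have hordt : ∀ k : ℤ, Scheme.ord (t ^ k) Q.point = k := fun k => by
    rw [ord_zpow_eq Q.codim_one ht0, ord_irreducible Q.codim_one hτ, mul_one]
  have hordz : ∀ ϖ : X.presheaf.stalk (π Q.point), Irreducible ϖ → P ∈ Δ.support →
      Scheme.ord (pullbackFunctions π (algebraMap _ X.functionField ϖ)) Q.point =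
        orbA Δ P := fun ϖ hϖ hPΔ => by
    rw [ord_pullbackFunctions π Q hP (algebraMap_ne_zero_of_irreducible hϖ),
      ord_irreducible hP hϖ, mul_one, hram hPΔ]
  constructor
  · intro hv
    refine ⟨fun f hf => ?_, fun hPΔ ϖ hϖ => ?_⟩
    · rw [← pairing_D]
      exact hv _ (Submodule.subset_span (Or.inl ⟨f, hf, rfl⟩))
    · have hz0 : pullbackFunctions π (algebraMap _ X.functionField ϖ) ≠ 0 :=
        (map_ne_zero _).2 (algebraMap_ne_zero_of_irreducible hϖ)
      have h1 := hv _ (Submodule.subset_span (Or.inr ⟨P, hPΔ, ϖ, ⟨specializes_rfl, ?_⟩,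
        (toFunctionField π).symm (t ^ orbB Δ P), ?_, rfl⟩))
      · rw [pairing_dlog, RingEquiv.apply_symm_apply] at h1
        have hne : t ^ (-(orbA Δ P : ℤ)) *
            pullbackFunctions π (algebraMap _ X.functionField ϖ) ≠ 0 :=
          mul_ne_zero (zpow_ne_zero _ ht0) hz0
        have h2 := mul_mem_of_ord h1 hne (by
          rw [Scheme.ord_mul (zpow_ne_zero _ ht0) hz0, hordt, hordz ϖ hϖ hPΔ]; omega)
        convert h2 using 1
        rw [sub_eq_add_neg, zpow_add₀ ht0]
        field_simp
      · rw [← hϖ.maximalIdeal_eq]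
        exact (P.ideal_point _).symm
      · right
        intro Q' hQ'
        rw [PrimeDivisor.eq_of_specializes hQ', RingEquiv.apply_symm_apply, hordt,
          orbifoldDivisor_apply π Δ Q hP (hram hPΔ)]
        exact (add_neg_cancel _).ge
  · rintro ⟨h1, h2⟩ ω hω
    induction hω using Submodule.span_induction with
    | zero => rw [pairing_zero_right]; exact zero_mem _
    | add ω ω' _ _ h h' => rw [pairing_add_right]; exact add_mem h h'
    | smul c ω _ h =>
      rw [Subring.smul_def, pairing_smul_right]; exact mul_mem c.2 h
    | mem ω hω =>
      rcases hω with ⟨f, hf, rfl⟩ | ⟨P', hPΔ, z, ⟨hsp, hz⟩, g, hg, rfl⟩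
      · rw [pairing_D]
        exact h1 f hf
      · obtain rfl : P' = P := PrimeDivisor.eq_of_specializes (Q := P) hsp
        have hz' := hz.trans (P.ideal_point _)
        have hzi : Irreducible z :=
          (IsDiscreteValuationRing.irreducible_iff_uniformizer z).2 hz'.symm
        have hz0 : pullbackFunctions π (algebraMap _ X.functionField z) ≠ 0 :=
          (map_ne_zero _).2 (algebraMap_ne_zero_of_irreducible hzi)
        rw [pairing_dlog]
        rcases hg with hg | hg
        · rw [hg, zero_mul]; exact zero_mem _
        · by_cases hg0 : toFunctionField π g = 0
          · rw [hg0, zero_mul]; exact zero_mem _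
          have hgQ := hg Q specializes_rfl
          rw [orbifoldDivisor_apply π Δ Q hP (hram hPΔ), ← hPdef] at hgQ
          have hgB : (orbB Δ P : ℚ) ≤ Scheme.ord (toFunctionField π g) Q.point := by linarith
          rw [Int.cast_le] at hgB
          have h3 := mul_mem_of_ord (h2 hPΔ z hzi)
            (mul_ne_zero (mul_ne_zero hg0 (inv_ne_zero hz0))
              (zpow_ne_zero ((orbA Δ P : ℤ) - orbB Δ P) ht0)) (by
            rw [Scheme.ord_mul (mul_ne_zero hg0 (inv_ne_zero hz0)) (zpow_ne_zero _ ht0),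
              Scheme.ord_mul hg0 (inv_ne_zero hz0), ord_inv_eq Q.codim_one hz0, hordt,
              hordz z hzi hPΔ]
            omega)
          convert h3 using 1
          have h4 : t ^ ((orbA Δ P : ℤ) - orbB Δ P) *
              t ^ (orbB Δ P - (orbA Δ P : ℤ)) = 1 := by
            rw [← zpow_add₀ ht0]
            simp
          linear_combination (-(toFunctionField π g *
            (pullbackFunctions π (algebraMap _ X.functionField z))⁻¹ *
            toFunctionField π (v (algebraMap _ X.functionField z)))) * h4

end OrbifoldTangent

/-! ### The local comparison of canonical classes -/

section LocalComparison

variable {X Y : Scheme.{0}} [IsIntegral X] [IsIntegral Y] [X.Over SpecC]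
  (π : Y ⟶ X) [IsDominant π] [Module.Finite X.functionField (FunctionFieldOver π)]
  [IsGalois X.functionField (FunctionFieldOver π)]
  [IsLocallyNoetherian X] [IsLocallyNoetherian Y] [LocallyOfFiniteType (X ↘ SpecC)]
  {W : Submodule Y.functionField (PullbackVectorField π)}

/-- Along `Q`, the sheaf `F = T(π, Δ) ∩ W` has a basis obtained from the pullback of a basis of
the descended sheaf on `X`; when `Q` lies over a horizontal component of `Δ`, the basis vector dual
to the differential of the local equation is multiplied by the `(a - b)`-th power of a uniformizer.
The factor `r` is the determinant of this change of basis. -/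
lemma exists_adapted_stalkBasis (hW : IsStableSubspace π W) {Δ : PrimeDivisor X →₀ ℚ}
    (hΔ0 : ∀ P, 0 ≤ Δ P) (hΔ1 : ∀ P, Δ P ≤ 1) (Q : PrimeDivisor Y)
    [IsDiscreteValuationRing (X.presheaf.stalk (π Q.point))]
    [IsDiscreteValuationRing (Y.presheaf.stalk Q.point)]
    (hP : Order.coheight (π Q.point) = 1)
    (hram : (⟨π Q.point, hP⟩ : PrimeDivisor X) ∈ Δ.support →
      ramificationIndex π Q = orbA Δ ⟨π Q.point, hP⟩)
    {F : StalkFamily Y (PullbackVectorField π)}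
    (hF : ∀ v : W, (v : PullbackVectorField π) ∈ F Q.point ↔
      (v : PullbackVectorField π) ∈ orbifoldTangent π Δ Q.point) :
    ∃ (b : Module.Basis (Fin (Module.finrank X.functionField (descendedFields π W)))
          X.functionField (descendedFields π W))
      (β : Module.Basis (Fin (Module.finrank X.functionField (descendedFields π W)))
          Y.functionField W) (r : Y.functionField),
      IsStalkBasis (vectorFieldsIn (descendedFields π W)) (π Q.point) b ∧
      IsStalkBasis F Q.point β ∧ r ≠ 0 ∧
      (∀ b₀, (pullbackBasis π hW b₀).det β = r * pullbackFunctions π (b₀.det b)) ∧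
      (Scheme.ord r Q.point : ℚ) = ramificationIndex π Q *
        horizontalPart (vectorFieldsIn (descendedFields π W)) Δ ⟨π Q.point, hP⟩ := by
  classical
  set P : PrimeDivisor X := ⟨π Q.point, hP⟩ with hPdef
  have hDVR : IsDiscreteValuationRing (X.presheaf.stalk P.point) :=
    inferInstanceAs (IsDiscreteValuationRing (X.presheaf.stalk (π Q.point)))
  obtain ⟨τ, hτ⟩ := IsDiscreteValuationRing.exists_irreducible (Y.presheaf.stalk Q.point)
  obtain ⟨ϖ, hϖ⟩ := IsDiscreteValuationRing.exists_irreducible (X.presheaf.stalk P.point)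
  have hmem := fun v => mem_orbifoldTangent_iff π hP hram hτ v
  rw [← hPdef] at hmem
  set t := algebraMap _ Y.functionField τ with ht
  have ht0 : t ≠ 0 := algebraMap_ne_zero_of_irreducible hτ
  have hordt : ∀ k : ℤ, Scheme.ord (t ^ k) Q.point = k := fun k => by
    rw [ord_zpow_eq Q.codim_one ht0, ord_irreducible Q.codim_one hτ, mul_one]
  have hB0 := orbB_nonneg (hΔ1 P)
  have hBA := orbB_le_orbA (hΔ0 P)
  -- a vector field is regular as soon as its coordinates are
  have hreg : ∀ (b : Module.Basis (Fin (Module.finrank X.functionField (descendedFields π W)))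
      X.functionField (descendedFields π W)),
      IsStalkBasis (vectorFieldsIn (descendedFields π W)) P.point b → ∀ v : W,
      (∀ i, (pullbackBasis π hW b).coord i v ∈ localRing Y Q.point) →
      ∀ f ∈ localRing X (π Q.point),
        toFunctionField π ((v : PullbackVectorField π) f) ∈ localRing Y Q.point := by
    intro b hb v hv f hf
    rw [apply_eq_sum_coord π hW b]
    exact sum_mem fun i _ => mul_mem (hv i)
      (pullbackFunctions_mem π _ ((hb.apply_mem i).1 f hf))
  by_cases hcase : P ∈ Δ.support ∧ ¬ IsInvariant (vectorFieldsIn (descendedFields π W)) P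
  · obtain ⟨hPΔ, hinv⟩ := hcase
    obtain ⟨b, i₀, hb1, hb2, hb3⟩ := exists_stalkBasis_of_not_isInvariant hϖ hinv
    -- the condition along `Q` only concerns the coordinate `i₀`, which is `v ↦ v ϖ`
    let w : Fin (Module.finrank X.functionField (descendedFields π W)) → Y.functionFieldˣ :=
      fun i => if i = i₀ then (Units.mk0 t ht0) ^ ((orbA Δ P : ℤ) - orbB Δ P) else 1
    refine ⟨b, (pullbackBasis π hW b).unitsSMul w, t ^ ((orbA Δ P : ℤ) - orbB Δ P), hb3,
      fun v => ?_, zpow_ne_zero _ ht0, fun b₀ => ?_, ?_⟩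
    · rw [hF, hmem]
      have hcoord : ∀ i, ((pullbackBasis π hW b).unitsSMul w).coord i v =
          (if i = i₀ then t ^ (orbB Δ P - (orbA Δ P : ℤ)) else 1) *
            (pullbackBasis π hW b).coord i v := by
        intro i
        rw [Module.Basis.coord_unitsSMul, LinearMap.smul_apply, Units.smul_def, smul_eq_mul]
        congr 1
        by_cases hi : i = i₀
        · simp only [w, if_pos hi]
          rw [← zpow_neg, neg_sub, Units.val_zpow_eq_zpow_val, Units.val_mk0]
        · simp only [w, if_neg hi, inv_one, Units.val_one]
      have hi₀ : (pullbackBasis π hW b).coord i₀ v =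
          toFunctionField π ((v : PullbackVectorField π) (algebraMap _ X.functionField ϖ)) :=
        coord_eq_apply π hW b hb2
      constructor
      · rintro ⟨h1, h2⟩ i
        rw [hcoord]
        by_cases hi : i = i₀
        · rw [if_pos hi, hi, hi₀]
          exact h2 hPΔ ϖ hϖ
        · rw [if_neg hi, one_mul]
          exact coord_mem_of_mem_span π hW b h1 (hb1 i)
      · intro h
        have h0 : t ^ (orbB Δ P - (orbA Δ P : ℤ)) *
            toFunctionField π ((v : PullbackVectorField π) (algebraMap _ X.functionField ϖ)) ∈
            localRing Y Q.point := by
          have := h i₀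
          rwa [hcoord, if_pos rfl, hi₀] at this
        have h1 : ∀ i, (pullbackBasis π hW b).coord i v ∈ localRing Y Q.point := by
          intro i
          have := h i
          rw [hcoord] at this
          by_cases hi : i = i₀
          · rw [if_pos hi] at this
            have h3 := mul_mem_of_ord this (zpow_ne_zero ((orbA Δ P : ℤ) - orbB Δ P) ht0)
              (by rw [hordt]; omega)
            rwa [← mul_assoc, ← zpow_add₀ ht0, sub_add_sub_cancel, sub_self, zpow_zero,
              one_mul] at h3
          · rwa [if_neg hi, one_mul] at this
        have h2 := hreg b hb3 v h1
        refine ⟨h2, fun _ ϖ' hϖ' => ?_⟩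
        -- two local equations differ by a unit, and `v (ϖ * u) = ϖ * v u + u * v ϖ`
        obtain ⟨u, rfl⟩ := IsDiscreteValuationRing.associated_of_irreducible _ hϖ hϖ'
        have h3 : toFunctionField π ((v : PullbackVectorField π)
            (algebraMap _ X.functionField (ϖ * (u : X.presheaf.stalk P.point)))) =
            pullbackFunctions π (algebraMap _ X.functionField ϖ) * toFunctionField π
              ((v : PullbackVectorField π) (algebraMap (X.presheaf.stalk P.point)
                X.functionField u)) +
            pullbackFunctions π (algebraMap (X.presheaf.stalk P.point) X.functionField u) *
              toFunctionField π ((v : PullbackVectorField π)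
                (algebraMap _ X.functionField ϖ)) := by
          rw [map_mul, Derivation.leibniz, map_add, Algebra.smul_def, Algebra.smul_def, map_mul,
            map_mul]
          rfl
        have hz0 : pullbackFunctions π (algebraMap _ X.functionField ϖ) ≠ 0 :=
          (map_ne_zero _).2 (algebraMap_ne_zero_of_irreducible hϖ)
        have h4 := mul_mem_of_ord (h2 _ ⟨(u : X.presheaf.stalk P.point), rfl⟩)
          (mul_ne_zero (zpow_ne_zero (orbB Δ P - (orbA Δ P : ℤ)) ht0) hz0) (by
            rw [Scheme.ord_mul (zpow_ne_zero _ ht0) hz0, hordt,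
              ord_pullbackFunctions π Q hP (algebraMap_ne_zero_of_irreducible hϖ),
              ord_irreducible hP hϖ, hram hPΔ]
            omega)
        have h5 := mul_mem (pullbackFunctions_mem π Q.point
          ⟨(u : X.presheaf.stalk P.point), rfl⟩) h0
        rw [h3]
        convert add_mem h4 h5 using 1
        ring
    · have hsm : ((pullbackBasis π hW b).unitsSMul w : _ → W) =
          fun i => (w i : Y.functionField) • pullbackBasis π hW b i :=
        funext fun i => Module.Basis.unitsSMul_apply i
      rw [hsm, AlternatingMap.map_smul_univ, pullbackBasis_det, smul_eq_mul]
      congr 1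
      rw [Finset.prod_eq_single i₀]
      · simp only [w, if_true]
        rw [Units.val_zpow_eq_zpow_val, Units.val_mk0]
      · intro i _ hi
        simp only [w, if_neg hi, Units.val_one]
      · exact fun h => absurd (Finset.mem_univ i₀) h
    · rw [hordt, horizontalPart, if_neg hinv, hram hPΔ, orbA_mul]
      push_cast
      rfl
  · obtain ⟨b, hb1, hb2⟩ := exists_stalkBasis (descendedFields π W) P.point
    refine ⟨b, pullbackBasis π hW b, 1, hb2, fun v => ?_, one_ne_zero, fun b₀ => ?_, ?_⟩
    · rw [hF, hmem]
      refine ⟨fun h i => coord_mem_of_mem_span π hW b h.1 (hb1 i), fun h => ⟨hreg b hb2 v h,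
        fun hPΔ ϖ' hϖ' => ?_⟩⟩
      -- `v ϖ'` is divisible by `ϖ'`, whose order along `Q` is `a`, and `b - a + a = b ≥ 0`
      have hinv : IsInvariant (vectorFieldsIn (descendedFields π W)) P := by
        by_contra hinv
        exact hcase ⟨hPΔ, hinv⟩
      rw [apply_eq_sum_coord π hW b, Finset.mul_sum]
      refine sum_mem fun i _ => ?_
      have hz0 : pullbackFunctions π (algebraMap _ X.functionField ϖ') ≠ 0 :=
        (map_ne_zero _).2 (algebraMap_ne_zero_of_irreducible hϖ')
      have h1 : (b i : RationalVectorField X)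
          (algebraMap (X.presheaf.stalk (π Q.point)) X.functionField ϖ') *
          (algebraMap (X.presheaf.stalk (π Q.point)) X.functionField ϖ')⁻¹ ∈
            localRing X (π Q.point) :=
        mul_inv_mem_of_isInvariant hϖ' hinv (hb2.apply_mem i)
      have h2 := mul_mem_of_ord (mul_mem (h i) (pullbackFunctions_mem π Q.point h1))
        (mul_ne_zero (zpow_ne_zero (orbB Δ P - (orbA Δ P : ℤ)) ht0) hz0) (by
          rw [Scheme.ord_mul (zpow_ne_zero _ ht0) hz0, hordt,
            ord_pullbackFunctions π Q hP (algebraMap_ne_zero_of_irreducible hϖ'),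
            ord_irreducible hP hϖ', hram hPΔ]
          omega)
      convert h2 using 1
      rw [map_mul, map_inv₀]
      field_simp
    · rw [pullbackBasis_det, one_mul]
    · rw [ord_one_eq Q.codim_one, horizontalPart]
      split_ifs with hinv
      · simp
      · rw [Finsupp.notMem_support_iff.1 fun h => hcase ⟨h, hinv⟩]
        simp

end LocalComparison

/-! ### The foliation on `X` -/

section Descended

variable {X Y : Scheme.{0}} [IsIntegral X] [IsIntegral Y] [X.Over SpecC]
  (π : Y ⟶ X) [IsDominant π] {F : StalkFamily Y (PullbackVectorField π)}

/-- Every automorphism of the function field extension is induced by an automorphism of `Y` over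
`X`, so stability of the stalks of `F` gives stability of its generic stalk. -/
lemma isStableSubspace_genericStalk [IsLocallyNoetherian X] [IsIntegralHom π]
    [Module.Finite X.functionField (FunctionFieldOver π)]
    [IsGalois X.functionField (FunctionFieldOver π)]
    (hY : ∀ U : Y.Opens, IsAffineOpen U → Nonempty U → IsIntegrallyClosed Γ(Y, U))
    (hF : IsGaloisStable π F) : IsStableSubspace π (genericStalk F) := by
  intro σ v hv
  obtain ⟨s, hs, hσ⟩ := exists_automorphism π hY σ
  have hgal : galoisAction π s hs = σ.toLinearMap := LinearMap.ext hσ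
  induction hv using Submodule.span_induction with
  | mem v hv =>
    obtain ⟨y, hy⟩ := Set.mem_iUnion.1 hv
    have hsy : s.hom (s.inv y) = y := by
      rw [← Scheme.Hom.comp_apply, s.inv_hom_id]
      rfl
    rw [← hgal]
    refine mem_genericStalk F (hF s hs (s.inv y) v ?_)
    rw [hsy]
    exact hy
  | zero =>
    have : σ.toLinearMap.compDer (0 : PullbackVectorField π) = 0 := map_zero _
    rw [this]
    exact zero_mem _
  | add v w _ _ hv hw =>
    have : σ.toLinearMap.compDer (v + w) = σ.toLinearMap.compDer v + σ.toLinearMap.compDer w :=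
      map_add _ _ _
    rw [this]
    exact add_mem hv hw
  | smul c v _ hv =>
    have : σ.toLinearMap.compDer (c • v) =
        toFunctionField π (σ ((toFunctionField π).symm c)) • σ.toLinearMap.compDer v := by
      ext f
      exact map_mul σ _ _
    rw [this]
    exact Submodule.smul_mem _ _ hv

lemma pullbackSheaf_vectorFieldsIn_le {W : Submodule Y.functionField (PullbackVectorField π)}
    {y : Y} {v : PullbackVectorField π}
    (hv : v ∈ pullbackSheaf π (vectorFieldsIn (descendedFields π W)) y) : v ∈ W := by
  induction hv using Submodule.span_induction with
  | mem v hv =>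
    obtain ⟨w, hw, rfl⟩ := hv
    exact hw.2
  | zero => exact zero_mem _
  | add v w _ _ hv hw => exact add_mem hv hw
  | smul c v _ hv => exact W.smul_mem (c : Y.functionField) hv

/-- Vector fields in the descended sheaf have multiples whose pullbacks lie in `F`, so their bracket
is tangent to `F` generically. -/
lemma vectorFieldsIn_bracket (hcoh : IsCoherent F) (hsurj : Function.Surjective π)
    (hF : PullbackBracketVanishes π (vectorFieldsIn (descendedFields π (genericStalk F))) F)
    (x : X) {u v : RationalVectorField X}
    (hu : u ∈ vectorFieldsIn (descendedFields π (genericStalk F)) x)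
    (hv : v ∈ vectorFieldsIn (descendedFields π (genericStalk F)) x) :
    ⁅u, v⁆ ∈ vectorFieldsIn (descendedFields π (genericStalk F)) x := by
  obtain ⟨y, rfl⟩ := hsurj x
  obtain ⟨g, hg, hgu⟩ := exists_smul_mem_stalk hcoh y hu.2
  obtain ⟨h, hh, hhv⟩ := exists_smul_mem_stalk hcoh y hv.2
  refine ⟨fun f hf => ?_, ?_⟩
  · rw [Derivation.commutator_apply]
    exact sub_mem (hu.1 _ (hv.1 _ hf)) (hv.1 _ (hu.1 _ hf))
  · have h1 := pullbackSheaf_vectorFieldsIn_le π (hF y 1 1 (fun _ => g) (fun _ => u) (fun _ => h)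
      (fun _ => v) (fun _ => hu) (fun _ => hv) (by simpa using hgu) (by simpa using hhv))
    simp only [Finset.univ_unique, Finset.sum_singleton] at h1
    have hgh : ((g * h : localRing Y y) : Y.functionField) ≠ 0 := by
      simpa using mul_ne_zero hg hh
    exact ((genericStalk F).smul_mem_iff hgh).1 h1

variable [Module.Finite X.functionField (FunctionFieldOver π)]
    [IsGalois X.functionField (FunctionFieldOver π)] [IsLocallyNoetherian X] [Flat π]

/-- The saturation of `F` in `π^* T_X` is the pullback of the descended sheaf. -/
lemma saturation_eq_pullbackSheaf (hcoh : IsCoherent F)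
    (hW : IsStableSubspace π (genericStalk F)) :
    saturation F (pullbackSheaf π (tangentSheaf X)) =
      pullbackSheaf π (vectorFieldsIn (descendedFields π (genericStalk F))) := by
  funext y
  refine le_antisymm ?_ ?_
  · rintro v ⟨hv, g, hg, hgv⟩
    have hg' : (g : Y.functionField) ≠ 0 := by simpa using hg
    exact mem_pullbackSheaf_vectorFieldsIn π hW y
      (((genericStalk F).smul_mem_iff hg').1 (mem_genericStalk F hgv)) hv
  · intro v hv
    refine ⟨Submodule.span_mono (Set.image_mono fun w hw => hw.1) hv, ?_⟩
    exact exists_smul_mem_stalk hcoh y (pullbackSheaf_vectorFieldsIn_le π hv)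

end Descended

end OrbifoldFoliation

end

theorem mainTheorem10 {X Y : Scheme.{0}} [IsIntegral X] [IsIntegral Y]
    [IsLocallyNoetherian X] [IsLocallyNoetherian Y] [X.Over SpecC]
    (hX : IsSmoothProjective (X ↘ SpecC))
    (Δ : PrimeDivisor X →₀ ℚ) (hΔ : IsOrbifold Δ)
    (π : Y ⟶ X) [IsDominant π] (hπ : IsAdaptedCover π Δ)
    (F : StalkFamily Y (PullbackVectorField π)) (hF : IsDeltaFoliation π Δ F) :
    ∃ FX : StalkFamily X (RationalVectorField X),
      IsFoliation FX ∧
      saturation F (pullbackSheaf π (tangentSheaf X)) = pullbackSheaf π FX ∧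
      (∃ D : PrimeDivisor X → ℤ, IsCanonicalDivisor FX D) ∧
      ∀ D : PrimeDivisor X → ℤ, IsCanonicalDivisor FX D →
        ∃ E : PrimeDivisor Y → ℤ, IsCanonicalDivisor F E ∧
          ∀ Q, (E Q : ℚ) = pullbackDivisor π (fun P => (D P : ℚ) + horizontalPart FX Δ P) Q := by

  classical
  have hXs := hX.smooth
  have hYs := hπ.smoothProjective.smooth
  have hfin := hπ.finite
  have hflat := hπ.flat
  have hgal := hπ.galois
  have hfd : Module.Finite X.functionField (FunctionFieldOver π) := finite_functionField π
  have hstab : IsStableSubspace π (genericStalk F) :=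
    isStableSubspace_genericStalk π
      (fun U hU _ => isIntegrallyClosed_section (π ≫ (X ↘ SpecC)) hU) hF.galoisStable
  have hsat := saturation_eq_pullbackSheaf π hF.coherent hstab
  set WX := descendedFields π (genericStalk F) with hWX
  have hgen := genericStalk_vectorFieldsIn WX
  have hDX : ∀ P : PrimeDivisor X, IsDiscreteValuationRing (X.presheaf.stalk P.point) :=
    fun P => isDiscreteValuationRing_stalk (X ↘ SpecC) P.codim_one
  have hbasis : ∀ P : PrimeDivisor X,
      ∃ b : Module.Basis (Fin (Module.finrank X.functionField WX)) X.functionField WX,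
        IsStalkBasis (vectorFieldsIn WX) P.point b := by
    intro P
    have := hDX P
    obtain ⟨b, -, hb⟩ := exists_stalkBasis WX P.point
    exact ⟨b, hb⟩
  let b₀ := Module.finBasis X.functionField WX
  refine ⟨vectorFieldsIn WX,
    ⟨vectorFieldsIn_coherent WX, vectorFieldsIn_saturated WX, fun x u hu v hv =>
      vectorFieldsIn_bracket π hF.coherent (surjective_of_isFinite π)
        (hF.bracket _ (vectorFieldsIn_coherent WX) (vectorFieldsIn_saturated WX) hsat) x hu hv⟩,
    hsat, ?_, fun D hD => ?_⟩
  · -- the divisor of the rational section of `det FX^*` given by the dual basis of `b₀`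
    choose b hb using hbasis
    exact ⟨fun P => Scheme.ord (1 * b₀.det (b P)) P.point,
      isCanonicalDivisor_of_ord_eq hgen b₀ one_ne_zero fun P => ⟨b P, hb P, rfl⟩⟩
  · -- the pullback of a section of `det FX^*` with divisor `D` is a section of `det F^*`
    obtain ⟨c, hc, hDc⟩ := hD.exists_ord_eq hgen b₀
    have hcod : ∀ Q : PrimeDivisor Y, Order.coheight (π Q.point) = 1 :=
      fun Q => coheight_apply_eq_one π Q.codim_one
    have hlocal : ∀ Q : PrimeDivisor Y, ∃ β : Module.Basis (Fin (Module.finrank X.functionField WX))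
        Y.functionField (genericStalk F), IsStalkBasis F Q.point β ∧
        (Scheme.ord (pullbackFunctions π c * (pullbackBasis π hstab b₀).det β) Q.point : ℚ) =
          pullbackDivisor π (fun P => (D P : ℚ) + horizontalPart (vectorFieldsIn WX) Δ P) Q := by
      intro Q
      have h1 : IsDiscreteValuationRing (X.presheaf.stalk (π Q.point)) := hDX ⟨_, hcod Q⟩
      have h2 : IsDiscreteValuationRing (Y.presheaf.stalk Q.point) :=
        isDiscreteValuationRing_stalk (π ≫ (X ↘ SpecC)) Q.codim_one
      obtain ⟨b, β, r, hb, hβ, hr, hdet, hord⟩ := exists_adapted_stalkBasis π hstab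
        hΔ.coeff_nonneg hΔ.coeff_le_one Q (hcod Q)
        (fun h => hπ.ramification ⟨_, hcod Q⟩ h Q rfl) (F := F) (fun v => by
          obtain ⟨hle, hs⟩ := hF.saturated Q.point
          refine ⟨fun h => hle h, fun h => ?_⟩
          obtain ⟨g, hg, hgv⟩ := exists_smul_mem_stalk hF.coherent Q.point v.2
          exact hs _ h g hg hgv)
      refine ⟨β, hβ, ?_⟩
      have hdet0 : b₀.det b ≠ 0 := (b₀.isUnit_det b).ne_zero
      have hcd0 : c * b₀.det b ≠ 0 := mul_ne_zero hc hdet0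
      have hprod : pullbackFunctions π c * (pullbackBasis π hstab b₀).det β =
          r * pullbackFunctions π (c * b₀.det b) := by
        rw [hdet, map_mul]
        ring
      rw [hprod, Scheme.ord_mul hr ((map_ne_zero _).2 hcd0),
        ord_pullbackFunctions π Q (hcod Q) hcd0,
        ← hDc ⟨_, hcod Q⟩ b hb, pullbackDivisor, dif_pos (hcod Q)]
      push_cast
      rw [hord]
      ring
    choose β hβ hE using hlocal
    exact ⟨_, isCanonicalDivisor_of_ord_eq rfl (pullbackBasis π hstab b₀)
      ((map_ne_zero (pullbackFunctions π)).2 hc) fun Q => ⟨β Q, hβ Q, rfl⟩, hE⟩
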